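/- Let $p,q\in\mathbb C$ with $|p|<1$ and $q\neq 0$, fix a square root $q^{1/2}$ of $q$, and let $N\ge 0$ be an integer. Put $$\theta(x;p)=\prod_{j=0}^\infty(1-p^jx)(1-p^{j+1}/x),\qquad \theta(x_1,\dots,x_n;p)=\prod_{i=1}^n\theta(x_i;p),\qquad (a;q,p)_k=\prod_{j=0}^{k-1}\theta(aq^j;p),$$ and, for $x=\xi+\xi^{-1}$ with $\xi\in\mathbb C\setminus\{0\}$ and $a\ne0$, $$h_k(x;a)=(a\xi;q,p)_k\,(a\xi^{-1};q,p)_k .$$ For $a,b,c\in\mathbb C\setminus\{0\}$ let $\Delta(a,b,c)$ be the difference operator $$\Delta(a,b,c)f(\xi)=\frac{\xi^{-2}\theta(a\xi,b\xi,c\xi,d\xi;p)f(q^{1/2}\xi)-\xi^{2}\theta(a\xi^{-1},b\xi^{-1},c\xi^{-1},d\xi^{-1};p)f(q^{-1/2}\xi)}{\xi\,\theta(\xi^{-2};p)},\qquad d=\frac{q^{-N}}{abc}.$$ The following identities hold as identities of functions of $\xi$, at every $\xi\neq0$ with $\theta(\xi^{-2};p)\neq0$. (i) For all $a,b,c\neq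 0$ and $0\le k\le N$, $$\Delta(a,b,c)\,h_k(x;q^{1/2}a)h_{N-k}(x;q^{1/2}b)=\frac{q^{-N}}{abc}\,\theta(q^kac,q^{N-k}bc,q^Nab;p)\,h_k(x;a)h_{N-k}(x;b).$$ (ii) Consequently the functions $e_k=h_k(x;q^{1/2}a)h_{N-k}(x;q^{1/2}b)$ solve a generalized eigenvalue problem: for all $a,b,c,c'\ne0$ and $0\le k\le N$, $$c\,\theta(q^kac',q^{N-k}bc';p)\,\Delta(a,b,c)e_k=c'\,\theta(q^kac,q^{N-k}bc;p)\,\Delta(a,b,c')e_k .$$ (iii) Let $a,b,c,\lambda,\mu\neq0$ be such that for all $m\in\mathbb Z$ (with $m=0$ only, if $p=0$) $$p^m\lambda/\mu\notin\{q^{1-N},q^{2-N},\dots,q^{N-1}\},\qquad p^mq\lambda\mu\notin\{q^{1-N},q^{2-N},\dots,1\}$$ (the condition for the functions $h_j(x;q^{1/2}\lambda)h_{N-j}(x;q^{1/2}\mu)$, $0\le j\le N$, to form a basis of the $(N+1)$-dimensional space they belong to). Then for $0\le k\le N$ $$\Delta(a,b,c)\,h_k(x;\lambda)h_{N-k}(x;\mu)\in\operatorname{span}_{\mathbb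 C}\{h_j(x;q^{1/2}\lambda)h_{N-j}(x;q^{1/2}\mu):\ \max(0,k-1)\le j\le\min(N,k+1)\}.$$ -/

import Mathlib

namespace EllipticSixJ

/-- The modified theta function
`θ(x;p) = ∏_{j ≥ 0} (1 - p^j x) (1 - p^{j+1} / x)`, used for `|p| < 1` and `x ≠ 0`. -/
noncomputable def theta (p x : ℂ) : ℂ :=
  ∏' j : ℕ, (1 - p ^ j * x) * (1 - p ^ (j + 1) / x)

/-- The elliptic shifted factorial `(a;q,p)_k = ∏_{j=0}^{k-1} θ(a q^j;p)`. -/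
noncomputable def ellPoch (p q a : ℂ) (k : ℕ) : ℂ :=
  ∏ j ∈ Finset.range k, theta p (a * q ^ j)

/-- The function `h_k(x;a) = h_k(x;a;q,p) = (aξ, aξ⁻¹;q,p)_k`, where `x = ξ + ξ⁻¹`,
written as a function of the uniformizing variable `ξ`. By `h_congr` below it
depends on `ξ` only through `x`. -/
noncomputable def h (p q : ℂ) (k : ℕ) (a ξ : ℂ) : ℂ :=
  ellPoch p q (a * ξ) k * ellPoch p q (a * ξ⁻¹) k

theorem h_congr (p q : ℂ) (k : ℕ) (a ξ η : ℂ) (hξ : ξ ≠ 0) (hη : η ≠ 0)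
    (hx : ξ + ξ⁻¹ = η + η⁻¹) : h p q k a ξ = h p q k a η := by
  have key : (ξ - η) * (ξ * η - 1) = 0 := by
    field_simp at hx
    linear_combination hx
  rcases mul_eq_zero.mp key with h1 | h1
  · rw [sub_eq_zero.mp h1]
  · have h2 : η = ξ⁻¹ := eq_inv_of_mul_eq_one_right (sub_eq_zero.mp h1)
    rw [h2, h, h, inv_inv, mul_comm]

/-- The product `h_k(x;a) h_{N-k}(x;b)` (for `0 ≤ k ≤ N`) as a function of `ξ`,
`x = ξ + ξ⁻¹`. -/
noncomputable def hh (p q : ℂ) (N : ℕ) (a b : ℂ) (k : ℕ) : ℂ → ℂ :=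
  fun ξ => h p q k a ξ * h p q (N - k) b ξ

/-- The difference operator `Δ(a,b,c,d)`; the parameter `r` is the chosen square
root `q^{1/2}`. The formula is meaningful at `ξ ≠ 0` with `θ(ξ⁻²;p) ≠ 0`. -/
noncomputable def delta4 (p r a b c d : ℂ) (f : ℂ → ℂ) : ℂ → ℂ := fun ξ =>
  (ξ⁻¹ ^ 2 * (theta p (a * ξ) * theta p (b * ξ) * theta p (c * ξ) * theta p (d * ξ))
        * f (r * ξ)
      - ξ ^ 2 * (theta p (a * ξ⁻¹) * theta p (b * ξ⁻¹) * theta p (c * ξ⁻¹) * theta p (d * ξ⁻¹))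
        * f (r⁻¹ * ξ))
    / (ξ * theta p (ξ⁻¹ ^ 2))

/-- `Δ(a,b,c) = Δ(a,b,c,q^{-N}/(abc))`. -/
noncomputable def delta (p q r : ℂ) (N : ℕ) (a b c : ℂ) : (ℂ → ℂ) → (ℂ → ℂ) :=
  delta4 p r a b c ((q ^ N)⁻¹ / (a * b * c))

/-- Equality of two functions of `ξ` at every point of `ℂ \ {0}` outside the discrete set
`θ(ξ⁻²;p) = 0`, that is, wherever the quotient defining `Δ` makes sense. -/
def EqRegular (p : ℂ) (F G : ℂ → ℂ) : Prop :=
  ∀ ξ : ℂ, ξ ≠ 0 → theta p (ξ⁻¹ ^ 2) ≠ 0 → F ξ = G ξ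

/-- The condition on the parameters under which `h_k(x;a) h_{N-k}(x;b)`, `0 ≤ k ≤ N`, form a basis:
`p^m a/b ∉ {q^{1-N}, …, q^{N-1}}` and `p^m ab ∉ {q^{1-N}, …, q^{-1}, 1}` for all integers `m`. -/
def Nonresonant (p q : ℂ) (N : ℕ) (a b : ℂ) : Prop :=
  (∀ m i : ℤ, 1 - (N : ℤ) ≤ i → i ≤ (N : ℤ) - 1 → p ^ m * (a / b) ≠ q ^ i) ∧
  (∀ m i : ℤ, 1 - (N : ℤ) ≤ i → i ≤ 0 → p ^ m * (a * b) ≠ q ^ i)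

end EllipticSixJ

/-! On functions symmetric under ξ ↦ ξ⁻¹, Δ is a divided antisymmetrization: Δf = (P(ξ) - P(ξ⁻¹)) /
(ξ θ(ξ⁻²)) with P(ξ) = ξ⁻² θ(aξ,bξ,cξ,dξ) f(q^{1/2}ξ) (`delta4_eq_antisym`). Symmetric factors of P
pass through it, and what remains is a product of theta functions whose parameters multiply to 1.

For e_k, the factors θ(aξ), θ(bξ) telescope with the shifted h's (`theta_mul_h`), leaving four theta
functions. Their antisymmetrization is a constant, by the three-term addition formula
(`antisym_four`). This is (i), and (ii) follows by comparing eigenvalues.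

For general λ, μ and 0 < k < N, eight theta functions remain after removing h_{k-1}(x;q^{1/2}λ)
h_{N-k-1}(x;q^{1/2}μ). The addition formula lowers the number from eight to six to four, each time
splitting off a symmetric pair θ(Aξ^±), so the result is quadratic in such pairs
(`antisym_eight_mem_of_prod`). The pairs span a space of dimension at most two, and nonresonance
lets the quadratics be written with the three products that restore j = k-1, k, k+1
(`symFun_mul_mem_span`). The reduction divides by theta values; their zeros are avoided by a density
argument (`mem_of_countable_exceptions`). At k = 0 and k = N six theta functions remain and two
terms suffice.

The addition formula comes from Jacobi's triple product: splitting the double series of θ(xy)θ(x/y)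
by parity shows a 2×2 determinant, and the formula is the Plücker relation for such determinants. -/

namespace EllipticSixJ

open Filter Topology

/-! ### Elementary properties of the theta function -/

/-- The infinite shifted factorial `(x;p)_∞ = ∏_{j ≥ 0} (1 - p^j x)`. -/
noncomputable def qInf (p x : ℂ) : ℂ := ∏' j : ℕ, (1 - p ^ j * x)

theorem summable_norm_pow_mul {p : ℂ} (hp : ‖p‖ < 1) (x : ℂ) :
    Summable fun j : ℕ => ‖-(p ^ j * x)‖ := by
  simp only [norm_neg, norm_mul, norm_pow]
  exact (summable_geometric_of_lt_one (norm_nonneg p) hp).mul_right _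

theorem multipliable_qInf {p : ℂ} (hp : ‖p‖ < 1) (x : ℂ) :
    Multipliable fun j : ℕ => (1 - p ^ j * x) := by
  simpa [sub_eq_add_neg] using multipliable_one_add_of_summable (summable_norm_pow_mul hp x)

theorem qInf_eq_mul {p : ℂ} (hp : ‖p‖ < 1) (x : ℂ) :
    qInf p x = (1 - x) * qInf p (p * x) := by
  have h1 := (multipliable_qInf hp x).tendsto_prod_tprod_nat.comp (tendsto_add_atTop_nat 1)
  have h2 := (multipliable_qInf hp (p * x)).tendsto_prod_tprod_nat.const_mul (1 - x)
  refine tendsto_nhds_unique h1 (h2.congr fun n => ?_)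
  simp only [Function.comp_apply, Finset.prod_range_succ', pow_zero, one_mul]
  rw [mul_comm]
  congr 1
  exact Finset.prod_congr rfl fun j _ => by ring

theorem theta_eq_qInf {p : ℂ} (hp : ‖p‖ < 1) (x : ℂ) :
    theta p x = qInf p x * qInf p (p / x) := by
  rw [qInf, qInf, ← (multipliable_qInf hp x).tprod_mul (multipliable_qInf hp (p / x)), theta]
  exact tprod_congr fun j => by ring

theorem theta_inv {p : ℂ} (hp : ‖p‖ < 1) {x : ℂ} (hx : x ≠ 0) :
    theta p x⁻¹ = -x⁻¹ * theta p x := by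
  rw [theta_eq_qInf hp, theta_eq_qInf hp, qInf_eq_mul hp x⁻¹, qInf_eq_mul hp x, div_inv_eq_mul,
    div_eq_mul_inv]
  field_simp
  ring

theorem exists_of_qInf_eq_zero {p : ℂ} (hp : ‖p‖ < 1) {x : ℂ} (h0 : qInf p x = 0) :
    ∃ j : ℕ, p ^ j * x = 1 := by
  by_contra! hne
  refine tprod_one_add_ne_zero_of_summable (f := fun j : ℕ => -(p ^ j * x)) (fun j => ?_)
    (summable_norm_pow_mul hp x) (by simpa [sub_eq_add_neg, qInf] using h0)
  rw [← sub_eq_add_neg, sub_ne_zero]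
  exact (hne j).symm

/-- The case p = 0 needs no separate clause: since 0 ^ m = 0 for m ≠ 0, the conclusion then forces m
= 0. -/
theorem exists_of_theta_eq_zero {p : ℂ} (hp : ‖p‖ < 1) {x : ℂ} (hx : x ≠ 0)
    (h0 : theta p x = 0) : ∃ m : ℤ, p ^ m * x = 1 := by
  rw [theta_eq_qInf hp, mul_eq_zero] at h0
  rcases h0 with h0 | h0
  · obtain ⟨j, hj⟩ := exists_of_qInf_eq_zero hp h0
    exact ⟨j, by simpa using hj⟩
  · obtain ⟨j, hj⟩ := exists_of_qInf_eq_zero hp h0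
    have hp0 : p ≠ 0 := by
      rintro rfl
      simp at hj
    refine ⟨-((j : ℤ) + 1), ?_⟩
    rw [zpow_neg, inv_mul_eq_one₀ (zpow_ne_zero _ hp0), zpow_add_one₀ hp0, zpow_natCast]
    field_simp at hj
    linear_combination hj

/-- The product converges locally uniformly on each ball of radius R, with majorant ‖p‖^j R. -/
theorem continuous_qInf {p : ℂ} (hp : ‖p‖ < 1) : Continuous (qInf p) := by
  rw [← continuousOn_univ]
  suffices H : ∀ R : ℝ, ContinuousOn (qInf p) (Metric.ball 0 R) by
    intro x _
    refine ((H (‖x‖ + 1)).continuousAt (Metric.isOpen_ball.mem_nhds ?_)).continuousWithinAt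
    simp
  intro R
  have h1 := Summable.hasProdLocallyUniformlyOn_nat_one_add
    (f := fun (j : ℕ) (x : ℂ) => -(p ^ j * x)) (K := Metric.ball 0 R)
    (u := fun j => ‖p‖ ^ j * R) Metric.isOpen_ball
    ((summable_geometric_of_lt_one (norm_nonneg p) hp).mul_right _)
    (.of_forall fun j x hx => by
      rw [norm_neg, norm_mul, norm_pow]
      rw [mem_ball_zero_iff] at hx
      gcongr)
    (fun j => by fun_prop)
  have h2 := h1.tendstoLocallyUniformlyOn_finsetRange.continuousOn
    (.of_forall fun n => by fun_prop)
  refine h2.congr fun x _ => ?_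
  simp [qInf, sub_eq_add_neg]

theorem continuousAt_theta {p : ℂ} (hp : ‖p‖ < 1) {x : ℂ} (hx : x ≠ 0) :
    ContinuousAt (theta p) x := by
  rw [show theta p = fun x => qInf p x * qInf p (p / x) from funext (theta_eq_qInf hp)]
  refine (continuous_qInf hp).continuousAt.mul ?_
  exact (continuous_qInf hp).continuousAt.comp (continuousAt_const.div continuousAt_id hx)

theorem theta_zero_left (x : ℂ) : theta 0 x = 1 - x := by
  rw [theta, tprod_eq_mulSingle 0]
  · simp
  · intro j hj
    simp [hj]

theorem countable_theta_zeros {p : ℂ} (hp : ‖p‖ < 1) {κ : ℂ} (hκ : κ ≠ 0) :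
    {a : ℂ | a ≠ 0 ∧ theta p (κ * a) = 0}.Countable := by
  refine (Set.countable_range fun m : ℤ => (p ^ m)⁻¹ / κ).mono ?_
  rintro a ⟨ha, h0⟩
  obtain ⟨m, hm⟩ := exists_of_theta_eq_zero hp (mul_ne_zero hκ ha) h0
  refine ⟨m, ?_⟩
  have : p ^ m ≠ 0 := by
    intro h
    simp [h] at hm
  field_simp
  linear_combination -hm

/-! ### The Laurent expansion of the theta function (Jacobi's triple product) -/

/-- The Laurent coefficient `(-1)^k p^{k(k-1)/2}`. -/
noncomputable def thetaCoeff (p : ℂ) (k : ℤ) : ℂ := (-1) ^ k * p ^ (k * (k - 1) / 2)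

theorem thetaCoeff_add_one {p : ℂ} (hp0 : p ≠ 0) (k : ℤ) :
    thetaCoeff p (k + 1) = -p ^ k * thetaCoeff p k := by
  have h1 : (k + 1) * (k + 1 - 1) / 2 = k * (k - 1) / 2 + k := by
    rw [show (k + 1) * (k + 1 - 1) = k * (k - 1) + k * 2 by ring,
      Int.add_mul_ediv_right _ _ two_ne_zero]
  rw [thetaCoeff, thetaCoeff, h1, zpow_add₀ hp0, zpow_add_one₀ (by norm_num)]
  ring

theorem thetaCoeff_sub_one {p : ℂ} (hp0 : p ≠ 0) (k : ℤ) :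
    thetaCoeff p (k - 1) = -(p / p ^ k) * thetaCoeff p k := by
  have h1 := thetaCoeff_add_one hp0 (k - 1)
  rw [sub_add_cancel, zpow_sub_one₀ hp0] at h1
  rw [h1]
  have : p ^ k ≠ 0 := zpow_ne_zero _ hp0
  field_simp

theorem thetaCoeff_ne_zero {p : ℂ} (hp0 : p ≠ 0) (k : ℤ) : thetaCoeff p k ≠ 0 :=
  mul_ne_zero (zpow_ne_zero _ (by norm_num)) (zpow_ne_zero _ hp0)

theorem summable_norm_thetaCoeff {p : ℂ} (hp : ‖p‖ < 1) (hp0 : p ≠ 0) {x : ℂ} (hx : x ≠ 0) :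
    Summable fun k : ℤ => ‖thetaCoeff p k * x ^ k‖ := by
  have hne : ∀ k : ℤ, thetaCoeff p k * x ^ k ≠ 0 := fun k =>
    mul_ne_zero (thetaCoeff_ne_zero hp0 k) (zpow_ne_zero _ hx)
  have hlim : ∀ c : ℝ, Tendsto (fun n : ℕ => ‖p‖ ^ n * c) atTop (𝓝 0) := fun c => by
    simpa using (tendsto_pow_atTop_nhds_zero_of_lt_one (norm_nonneg p) hp).mul_const c
  refine Summable.of_nat_of_neg_add_one ?_ ?_
  · refine summable_of_ratio_test_tendsto_lt_one zero_lt_one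
      (.of_forall fun n => norm_ne_zero_iff.mpr (hne n)) ((hlim ‖x‖).congr fun n => ?_)
    obtain ⟨h1, -⟩ := mul_ne_zero_iff.mp (hne n)
    rw [norm_norm, norm_norm, ← norm_div, ← norm_pow, ← norm_mul]
    push_cast
    rw [thetaCoeff_add_one hp0, zpow_add_one₀ hx, zpow_natCast p, ← norm_neg]
    congr 1
    field_simp
  · refine summable_of_ratio_test_tendsto_lt_one zero_lt_one
      (.of_forall fun n => norm_ne_zero_iff.mpr (hne _)) ((hlim ‖p ^ 2 / x‖).congr fun n => ?_)
    obtain ⟨h1, -⟩ := mul_ne_zero_iff.mp (hne (-((n : ℤ) + 1)))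
    rw [norm_norm, norm_norm, ← norm_div, ← norm_pow, ← norm_mul]
    push_cast
    rw [show -((n : ℤ) + 1 + 1) = -((n : ℤ) + 1) - 1 by ring, thetaCoeff_sub_one hp0,
      zpow_sub_one₀ hx, zpow_neg p, zpow_add_one₀ hp0, zpow_natCast p, ← norm_neg]
    congr 1
    field_simp

/-! ### The finite triple product and its limit -/

/-- The reciprocal of `(p;p)_m`, extended by zero to negative integers `m`. -/
noncomputable def invPoch (p : ℂ) (m : ℤ) : ℂ :=
  if m < 0 then 0 else (∏ j ∈ Finset.range m.toNat, (1 - p ^ j * p))⁻¹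

theorem one_sub_pow_mul_ne_zero {p : ℂ} (hp : ‖p‖ < 1) (j : ℕ) : 1 - p ^ j * p ≠ 0 := by
  rw [sub_ne_zero]
  intro h
  have h1 : ‖p ^ (j + 1)‖ = 1 := by rw [pow_succ, ← h, norm_one]
  rw [norm_pow] at h1
  exact (pow_lt_one₀ (norm_nonneg p) hp j.succ_ne_zero).ne h1

theorem invPoch_natCast (p : ℂ) (n : ℕ) :
    invPoch p n = (∏ j ∈ Finset.range n, (1 - p ^ j * p))⁻¹ := by
  simp [invPoch]

theorem invPoch_of_neg {p : ℂ} {m : ℤ} (hm : m < 0) : invPoch p m = 0 := by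
  simp [invPoch, hm]

/-- The extension by zero respects the recursion because the factor 1 - p^{m+1} vanishes at m = -1.
Hence sums over all of ℤ have no boundary terms. -/
theorem invPoch_eq {p : ℂ} (hp : ‖p‖ < 1) (hp0 : p ≠ 0) (m : ℤ) :
    invPoch p m = (1 - p ^ m * p) * invPoch p (m + 1) := by
  rcases lt_or_ge m 0 with hm | hm
  · rw [invPoch_of_neg hm]
    rcases eq_or_ne m (-1) with rfl | hm1
    · simp [hp0]
    · rw [invPoch_of_neg (by omega), mul_zero]
  · lift m to ℕ using hm
    rw [show (m : ℤ) + 1 = ((m + 1 : ℕ) : ℤ) by simp, invPoch_natCast, invPoch_natCast,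
      Finset.prod_range_succ, zpow_natCast]
    rw [mul_inv_rev, mul_inv_cancel_left₀ (one_sub_pow_mul_ne_zero hp m)]

theorem tendsto_invPoch {p : ℂ} (hp : ‖p‖ < 1) :
    Tendsto (invPoch p) atTop (𝓝 (qInf p p)⁻¹) := by
  have h0 : qInf p p ≠ 0 := by
    intro h
    obtain ⟨j, hj⟩ := exists_of_qInf_eq_zero hp h
    exact one_sub_pow_mul_ne_zero hp j (by rw [hj, sub_self])
  have hnat : Tendsto Int.toNat atTop atTop :=
    tendsto_atTop_atTop.mpr fun b => ⟨b, fun a ha => by omega⟩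
  have h1 := ((multipliable_qInf hp p).tendsto_prod_tprod_nat.inv₀ h0).comp hnat
  refine h1.congr' ?_
  filter_upwards [eventually_ge_atTop 0] with m hm
  simp [invPoch, not_lt.mpr hm]

theorem exists_norm_invPoch_le {p : ℂ} (hp : ‖p‖ < 1) : ∃ B, ∀ m, ‖invPoch p m‖ ≤ B := by
  have h1 : Tendsto (fun n : ℕ => ‖invPoch p n‖) atTop (𝓝 ‖(qInf p p)⁻¹‖) :=
    ((tendsto_invPoch hp).comp tendsto_natCast_atTop_atTop).norm
  obtain ⟨B, hB⟩ := h1.bddAbove_range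
  have hB' : ∀ n : ℕ, ‖invPoch p n‖ ≤ B := fun n => hB ⟨n, rfl⟩
  refine ⟨B, fun m => ?_⟩
  rcases lt_or_ge m 0 with hm | hm
  · rw [invPoch_of_neg hm, norm_zero]
    exact (norm_nonneg _).trans (hB' 0)
  · lift m to ℕ using hm
    exact hB' m

/-- The coefficients of the finite form of the triple product, up to a factor `(p;p)_{2n}`. -/
noncomputable def finiteThetaCoeff (p : ℂ) (n : ℕ) (k : ℤ) : ℂ :=
  thetaCoeff p k * (invPoch p (n + k) * invPoch p (n - k))

/-- Coefficient form of multiplication by (1 - p^n x)(1 - p^{n+1}/x); the right-hand factors are the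
two new ones in (p;p)_{2n+2}. -/
theorem finiteThetaCoeff_succ {p : ℂ} (hp : ‖p‖ < 1) (hp0 : p ≠ 0) (n : ℕ) (k : ℤ) :
    (1 + p ^ n * p ^ n * p) * finiteThetaCoeff p n k - p ^ n * finiteThetaCoeff p n (k - 1)
      - p ^ n * p * finiteThetaCoeff p n (k + 1)
      = (1 - p ^ (2 * n) * p) * (1 - p ^ (2 * n + 1) * p) * finiteThetaCoeff p (n + 1) k := by
  simp only [finiteThetaCoeff, thetaCoeff_add_one hp0, thetaCoeff_sub_one hp0]
  have hK : p ^ k ≠ 0 := zpow_ne_zero _ hp0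
  have e1 := invPoch_eq hp hp0 (n + k)
  have e2 := invPoch_eq hp hp0 (n - k)
  have e3 := invPoch_eq hp hp0 (n + k - 1)
  have e4 := invPoch_eq hp hp0 (n - k - 1)
  rw [sub_add_cancel] at e3 e4
  rw [show (n : ℤ) + (k - 1) = n + k - 1 by ring, show (n : ℤ) - (k - 1) = n - k + 1 by ring,
    show (n : ℤ) + (k + 1) = n + k + 1 by ring, show (n : ℤ) - (k + 1) = n - k - 1 by ring,
    show ((n + 1 : ℕ) : ℤ) + k = n + k + 1 by push_cast; ring,
    show ((n + 1 : ℕ) : ℤ) - k = n - k + 1 by push_cast; ring, e3, e4, e1, e2]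
  rw [zpow_sub_one₀ hp0, zpow_sub_one₀ hp0, zpow_add₀ hp0, zpow_sub₀ hp0, zpow_natCast]
  generalize invPoch p (n + k + 1) = u
  generalize invPoch p (n - k + 1) = v
  rw [show p ^ (2 * n) = p ^ n * p ^ n by ring, show p ^ (2 * n + 1) = p ^ n * p ^ n * p by ring]
  generalize p ^ n = P
  generalize p ^ k = K at *
  field_simp
  ring

theorem hasSum_congr_of_eq {ι : Type*} {f g : ι → ℂ} {a b : ℂ} (hf : HasSum f a)
    (hfg : ∀ k, g k = f k) (hab : b = a) : HasSum g b := by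
  rwa [hab, funext hfg]

theorem hasSum_finite_triple_product {p : ℂ} (hp : ‖p‖ < 1) (hp0 : p ≠ 0) {x : ℂ} (hx : x ≠ 0)
    (n : ℕ) :
    HasSum (fun k : ℤ => (∏ j ∈ Finset.range (2 * n), (1 - p ^ j * p)) *
        (finiteThetaCoeff p n k * x ^ k))
      (∏ j ∈ Finset.range n, (1 - p ^ j * x) * (1 - p ^ (j + 1) / x)) := by
  induction n with
  | zero =>
    convert hasSum_single (0 : ℤ) ?_ using 1
    · simp [finiteThetaCoeff, thetaCoeff, invPoch]
    · intro k hk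
      rcases lt_or_gt_of_ne hk with hk | hk
      · simp [finiteThetaCoeff, invPoch_of_neg hk]
      · rw [finiteThetaCoeff, invPoch_of_neg (m := ((0 : ℕ) : ℤ) - k) (by simpa using hk)]
        simp
  | succ n ih =>
    have h1 := (Equiv.subRight (1 : ℤ)).hasSum_iff.mpr ih
    have h2 := (Equiv.addRight (1 : ℤ)).hasSum_iff.mpr ih
    have h3 := ((ih.mul_left (1 + p ^ n * p ^ n * p)).sub (h1.mul_left (p ^ n * x))).sub
      (h2.mul_left (p ^ n * p / x))
    rw [Finset.prod_range_succ]
    refine hasSum_congr_of_eq h3 (fun k => ?_) ?_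
    · simp only [Function.comp_apply, Equiv.subRight_apply, Equiv.coe_addRight]
      rw [show 2 * (n + 1) = 2 * n + 1 + 1 by ring, Finset.prod_range_succ,
        Finset.prod_range_succ, zpow_add_one₀ hx, zpow_sub_one₀ hx]
      have h4 := finiteThetaCoeff_succ hp hp0 n k
      generalize ∏ j ∈ Finset.range (2 * n), (1 - p ^ j * p) = D
      field_simp
      linear_combination -D * h4
    · generalize ∏ j ∈ Finset.range n, (1 - p ^ j * x) * (1 - p ^ (j + 1) / x) = D
      field_simp
      ring

/-- Jacobi's triple product identity, without the value of the constant. -/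
theorem exists_theta_eq_tsum {p : ℂ} (hp : ‖p‖ < 1) (hp0 : p ≠ 0) :
    ∃ C : ℂ, ∀ x : ℂ, x ≠ 0 → theta p x = C * ∑' k : ℤ, thetaCoeff p k * x ^ k := by
  refine ⟨qInf p p * ((qInf p p)⁻¹ * (qInf p p)⁻¹), fun x hx => ?_⟩
  obtain ⟨B, hB⟩ := exists_norm_invPoch_le hp
  have hcast : Tendsto (fun n : ℕ => (n : ℤ)) atTop atTop := tendsto_natCast_atTop_atTop
  -- Let n → ∞ in the finite identity by dominated convergence: both reciprocal factorials are
  -- bounded by B and tend to 1/(p;p)_∞.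
  have h1 : Tendsto (fun n : ℕ => ∑' k : ℤ, finiteThetaCoeff p n k * x ^ k) atTop
      (𝓝 (∑' k : ℤ, thetaCoeff p k * ((qInf p p)⁻¹ * (qInf p p)⁻¹) * x ^ k)) := by
    refine tendsto_tsum_of_dominated_convergence
      ((summable_norm_thetaCoeff hp hp0 hx).mul_right (B * B)) (fun k => ?_)
      (.of_forall fun n k => ?_)
    · refine (Tendsto.const_mul _ (Tendsto.mul ?_ ?_)).mul_const _
      · exact (tendsto_invPoch hp).comp (tendsto_atTop_add_const_right _ k hcast)
      · exact (tendsto_invPoch hp).comp (tendsto_atTop_add_const_right _ (-k) hcast)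
    · rw [finiteThetaCoeff, mul_right_comm, norm_mul, norm_mul (invPoch p _)]
      gcongr
      · exact (norm_nonneg _).trans (hB 0)
      · exact hB _
      · exact hB _
  have h2 : Tendsto (fun n : ℕ => ∏ j ∈ Finset.range (2 * n), (1 - p ^ j * p)) atTop
      (𝓝 (qInf p p)) :=
    (multipliable_qInf hp p).tendsto_prod_tprod_nat.comp
      (tendsto_id.const_mul_atTop' two_pos)
  have h3 : Tendsto (fun n => ∏ j ∈ Finset.range n, (1 - p ^ j * x) * (1 - p ^ (j + 1) / x)) atTop
      (𝓝 (theta p x)) := by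
    refine Multipliable.tendsto_prod_tprod_nat
      (((multipliable_qInf hp x).mul (multipliable_qInf hp (p / x))).congr fun j => ?_)
    ring
  refine tendsto_nhds_unique h3 (((h2.mul h1).congr fun n => ?_).trans_eq ?_)
  · rw [← tsum_mul_left, (hasSum_finite_triple_product hp hp0 hx n).tsum_eq]
  · have h4 : ∑' k : ℤ, thetaCoeff p k * ((qInf p p)⁻¹ * (qInf p p)⁻¹) * x ^ k
        = (qInf p p)⁻¹ * (qInf p p)⁻¹ * ∑' k : ℤ, thetaCoeff p k * x ^ k := by
      rw [← tsum_mul_left]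
      exact tsum_congr fun k => by ring
    rw [h4]
    simp only [mul_assoc]

/-! ### The addition formula -/

theorem two_mul_triangle (k : ℤ) : 2 * (k * (k - 1) / 2) = k * (k - 1) :=
  Int.mul_ediv_cancel' (Int.even_mul_pred_self k).two_dvd

/-- Series in p^{k²} are theta series of nome p², so their summability is already known. -/
theorem thetaCoeff_sq_mul {p : ℂ} (hp0 : p ≠ 0) (k : ℤ) (y : ℂ) :
    thetaCoeff (p ^ 2) k * (-(p * y)) ^ k = p ^ (k * k) * y ^ k := by
  have h1 : ((p ^ 2 : ℂ)) ^ (k * (k - 1) / 2) * p ^ k = p ^ (k * k) := by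
    rw [← zpow_natCast p 2, ← zpow_mul, ← zpow_add₀ hp0, Nat.cast_ofNat, two_mul_triangle]
    ring_nf
  have h2 : ((-1 : ℂ)) ^ k * (-1) ^ k = 1 := by
    rw [← mul_zpow]
    simp
  rw [thetaCoeff, ← neg_one_mul (p * y), mul_zpow, mul_zpow, ← h1]
  linear_combination ((p ^ 2 : ℂ)) ^ (k * (k - 1) / 2) * p ^ k * y ^ k * h2

/-- Index pairs of equal parity are (s + t, s - t); in these coordinates the quadratic exponent is
diagonal, so the double sum separates. -/
theorem thetaCoeff_mul_even {p : ℂ} (hp0 : p ≠ 0) (s t : ℤ) :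
    thetaCoeff p (s + t) * thetaCoeff p (s - t) = p ^ (s * s - s) * p ^ (t * t) := by
  have h1 := two_mul_triangle (s + t)
  have h2 := two_mul_triangle (s - t)
  have h3 : ((-1 : ℂ)) ^ (s + t) * (-1) ^ (s - t) = 1 := by
    rw [← zpow_add₀ (by norm_num), show s + t + (s - t) = 2 * s by ring, zpow_mul]
    simp
  have h4 : (s + t) * (s + t - 1) / 2 + (s - t) * (s - t - 1) / 2 = s * s - s + t * t := by
    linarith
  rw [thetaCoeff, thetaCoeff, ← zpow_add₀ hp0, ← h4, zpow_add₀ hp0]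
  linear_combination p ^ ((s + t) * (s + t - 1) / 2) * p ^ ((s - t) * (s - t - 1) / 2) * h3

theorem thetaCoeff_mul_odd {p : ℂ} (hp0 : p ≠ 0) (s t : ℤ) :
    thetaCoeff p (s + t + 1) * thetaCoeff p (s - t) = -(p ^ (s * s) * p ^ (t * t + t)) := by
  have h1 := thetaCoeff_mul_even hp0 s t
  rw [thetaCoeff_add_one hp0, mul_assoc, h1, ← zpow_add₀ hp0, ← zpow_add₀ hp0, neg_mul,
    ← zpow_add₀ hp0]
  ring_nf

theorem summable_norm_even {p : ℂ} (hp : ‖p‖ < 1) (hp0 : p ≠ 0) {y : ℂ} (hy : y ≠ 0) :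
    Summable fun k : ℤ => ‖p ^ (k * k) * y ^ k‖ := by
  have hp2 : ‖p ^ 2‖ < 1 := by
    rw [norm_pow]
    exact pow_lt_one₀ (norm_nonneg p) hp two_ne_zero
  exact (summable_norm_thetaCoeff hp2 (pow_ne_zero 2 hp0)
    (neg_ne_zero.mpr (mul_ne_zero hp0 hy))).congr fun k => by rw [thetaCoeff_sq_mul hp0]

/-- The function `∑ p^{k²} x^{2k}`. -/
noncomputable def thetaEven (p x : ℂ) : ℂ := ∑' k : ℤ, p ^ (k * k) * (x ^ 2) ^ k

/-- The function `∑ p^{k² + k} x^{2k + 1}`. -/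
noncomputable def thetaOdd (p x : ℂ) : ℂ := x * ∑' k : ℤ, p ^ (k * k) * (p * x ^ 2) ^ k

theorem mul_thetaOdd {p : ℂ} (hp0 : p ≠ 0) {x : ℂ} (hx : x ≠ 0) :
    x * thetaOdd p x = ∑' k : ℤ, p ^ (k * k) * (x ^ 2 / p) ^ k := by
  rw [thetaOdd, ← mul_assoc, ← sq, ← tsum_mul_left, 
    ← (Equiv.addRight (1 : ℤ)).tsum_eq fun k => p ^ (k * k) * (x ^ 2 / p) ^ k]
  refine tsum_congr fun k => ?_
  rw [Equiv.coe_addRight, show (k + 1) * (k + 1) = k * k + k + k + 1 by ring,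
    zpow_add_one₀ hp0, zpow_add₀ hp0, zpow_add₀ hp0, div_zpow, mul_zpow, zpow_add_one₀ hp0,
    zpow_add_one₀ (pow_ne_zero 2 hx)]
  have : p ^ k ≠ 0 := zpow_ne_zero _ hp0
  field_simp

/-- The term of index (m, n) carries x^{m+n} y^{m-n}. The maps g₁ and g₂ parametrize m + n even and
odd, and on each class the sum factors into a series in x times a series in y. -/
theorem tsum_mul_tsum_parity {p : ℂ} (hp : ‖p‖ < 1) (hp0 : p ≠ 0) {x y : ℂ} (hx : x ≠ 0)
    (hy : y ≠ 0) :
    (∑' k : ℤ, thetaCoeff p k * (x * y) ^ k) * (∑' k : ℤ, thetaCoeff p k * (x / y) ^ k)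
      = x * (thetaOdd p x * thetaEven p y - thetaEven p x * thetaOdd p y) := by
  have hs1 := summable_norm_thetaCoeff hp hp0 (mul_ne_zero hx hy)
  have hs2 := summable_norm_thetaCoeff hp hp0 (div_ne_zero hx hy)
  have hx2 : x ^ 2 ≠ 0 := pow_ne_zero 2 hx
  have hy2 : y ^ 2 ≠ 0 := pow_ne_zero 2 hy
  set F : ℤ × ℤ → ℂ := fun z =>
    (thetaCoeff p z.1 * (x * y) ^ z.1) * (thetaCoeff p z.2 * (x / y) ^ z.2) with hF
  set g₁ : ℤ × ℤ → ℤ × ℤ := fun z => (z.1 + z.2, z.1 - z.2) with hg₁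
  set g₂ : ℤ × ℤ → ℤ × ℤ := fun z => (z.1 + z.2 + 1, z.1 - z.2) with hg₂
  have hi₁ : Function.Injective g₁ := by
    rintro ⟨a, b⟩ ⟨c, d⟩ h
    simp only [hg₁, Prod.mk.injEq] at h ⊢
    omega
  have hi₂ : Function.Injective g₂ := by
    rintro ⟨a, b⟩ ⟨c, d⟩ h
    simp only [hg₂, Prod.mk.injEq] at h ⊢
    omega
  have hcompl : IsCompl (Set.range g₁) (Set.range g₂) := by
    constructor
    · rw [Set.disjoint_left]
      rintro _ ⟨⟨a, b⟩, rfl⟩ ⟨⟨c, d⟩, h⟩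
      simp only [hg₁, hg₂, Prod.mk.injEq] at h
      omega
    · refine codisjoint_iff.mpr (Set.eq_univ_iff_forall.mpr ?_)
      rintro ⟨m, n⟩
      rcases Int.even_or_odd' (m + n) with ⟨s, hs | hs⟩
      · exact .inl ⟨(s, m - s), by simp only [hg₁, Prod.mk.injEq]; omega⟩
      · exact .inr ⟨(s, m - s - 1), by simp only [hg₂, Prod.mk.injEq]; omega⟩
  have h₁ : HasSum (F ∘ g₁) (x * thetaOdd p x * thetaEven p y) := by
    have ha := summable_norm_even hp hp0 (div_ne_zero hx2 hp0)
    have hb := summable_norm_even hp hp0 hy2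
    rw [mul_thetaOdd hp0 hx, thetaEven, tsum_mul_tsum_of_summable_norm ha hb]
    refine hasSum_congr_of_eq (summable_mul_of_summable_norm ha hb).hasSum ?_ rfl
    rintro ⟨s, t⟩
    have h3 := thetaCoeff_mul_even hp0 s t
    rw [zpow_sub₀ hp0] at h3
    have hps : p ^ s ≠ 0 := zpow_ne_zero _ hp0
    have hxt : x ^ t ≠ 0 := zpow_ne_zero _ hx
    have hys : y ^ s ≠ 0 := zpow_ne_zero _ hy
    have hyt : y ^ t ≠ 0 := zpow_ne_zero _ hy
    simp only [hF, hg₁, Function.comp_apply]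
    rw [mul_mul_mul_comm, h3]
    simp only [mul_zpow, div_zpow, zpow_add₀ hx, zpow_sub₀ hx, zpow_add₀ hy, zpow_sub₀ hy,
      sq]
    field_simp
  have h₂ : HasSum (F ∘ g₂) (-(x * thetaEven p x * thetaOdd p y)) := by
    have ha := summable_norm_even hp hp0 hx2
    have hb := summable_norm_even hp hp0 (mul_ne_zero hp0 hy2)
    rw [thetaOdd, thetaEven, show ∀ A B : ℂ, -(x * A * (y * B)) = -(x * y) * (A * B) by
      intros; ring, tsum_mul_tsum_of_summable_norm ha hb]
    refine hasSum_congr_of_eq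
      ((summable_mul_of_summable_norm ha hb).hasSum.mul_left (-(x * y))) ?_ rfl
    rintro ⟨s, t⟩
    have h3 := thetaCoeff_mul_odd hp0 s t
    rw [zpow_add₀ hp0] at h3
    have hxt : x ^ t ≠ 0 := zpow_ne_zero _ hx
    have hys : y ^ s ≠ 0 := zpow_ne_zero _ hy
    have hyt : y ^ t ≠ 0 := zpow_ne_zero _ hy
    simp only [hF, hg₂, Function.comp_apply]
    rw [mul_mul_mul_comm, h3]
    simp only [mul_zpow, div_zpow, zpow_add₀ hx, zpow_sub₀ hx, zpow_add₀ hy, zpow_sub₀ hy,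
      sq, zpow_one]
    field_simp
  have h₃ : HasSum F _ :=
    HasSum.add_isCompl hcompl (hi₁.hasSum_range_iff.mpr h₁) (hi₂.hasSum_range_iff.mpr h₂)
  rw [tsum_mul_tsum_of_summable_norm hs1 hs2, h₃.tsum_eq]
  ring

/-- Up to the factor C x, the product is the 2×2 determinant of the vectors (e, o) at x and y. For p
= 0 one may take e = 1, o = x + 1/x. -/
theorem exists_theta_mul_theta {p : ℂ} (hp : ‖p‖ < 1) :
    ∃ (C : ℂ) (e o : ℂ → ℂ), ∀ x y : ℂ, x ≠ 0 → y ≠ 0 →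
      theta p (x * y) * theta p (x / y) = C * x * (o x * e y - e x * o y) := by
  by_cases hp0 : p = 0
  · subst hp0
    refine ⟨1, fun _ => 1, fun x => x + x⁻¹, fun x y hx hy => ?_⟩
    rw [theta_zero_left, theta_zero_left]
    field_simp
    ring
  · obtain ⟨C, hC⟩ := exists_theta_eq_tsum hp hp0
    refine ⟨C ^ 2, thetaEven p, thetaOdd p, fun x y hx hy => ?_⟩
    rw [hC _ (mul_ne_zero hx hy), hC _ (div_ne_zero hx hy)]
    linear_combination C ^ 2 * tsum_mul_tsum_parity hp hp0 hx hy

/-- The three-term addition formula for the theta function. -/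
theorem theta_addition {p : ℂ} (hp : ‖p‖ < 1) {x y u v : ℂ} (hx : x ≠ 0) (hy : y ≠ 0)
    (hu : u ≠ 0) (hv : v ≠ 0) :
    theta p (x * y) * theta p (x / y) * (theta p (u * v) * theta p (u / v))
      - theta p (x * v) * theta p (x / v) * (theta p (u * y) * theta p (u / y))
      = u / y * (theta p (y * v) * theta p (y / v) * (theta p (x * u) * theta p (x / u))) := by
  -- What remains is the Plücker relation for four vectors in the plane.
  obtain ⟨C, e, o, H⟩ := exists_theta_mul_theta hp
  rw [H x y hx hy, H u v hu hv, H x v hx hv, H u y hu hy, H y v hy hv, H x u hx hu]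
  field_simp
  ring

/-! ### Antisymmetrization and the difference operator -/

/-- The divided antisymmetrization `(P(ξ) - P(ξ⁻¹)) / (ξ θ(ξ⁻²;p))`. -/
noncomputable def antisym (p : ℂ) (P : ℂ → ℂ) (ξ : ℂ) : ℂ :=
  (P ξ - P ξ⁻¹) / (ξ * theta p (ξ⁻¹ ^ 2))

theorem antisym_mul_of_symm {p : ℂ} {S : ℂ → ℂ} (P : ℂ → ℂ) {ξ : ℂ} (hS : S ξ⁻¹ = S ξ) :
    antisym p (fun ξ => S ξ * P ξ) ξ = S ξ * antisym p P ξ := by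
  simp only [antisym, hS]
  ring

theorem antisym_const_mul {p : ℂ} (c : ℂ) (P : ℂ → ℂ) (ξ : ℂ) :
    antisym p (fun ξ => c * P ξ) ξ = c * antisym p P ξ :=
  antisym_mul_of_symm (S := fun _ => c) P rfl

theorem antisym_add {p : ℂ} (P Q : ℂ → ℂ) (ξ : ℂ) :
    antisym p (fun ξ => P ξ + Q ξ) ξ = antisym p P ξ + antisym p Q ξ := by
  simp only [antisym]
  ring

theorem antisym_congr {p : ℂ} {P Q : ℂ → ℂ} (hPQ : ∀ ξ, ξ ≠ 0 → P ξ = Q ξ) {ξ : ℂ}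
    (hξ : ξ ≠ 0) : antisym p P ξ = antisym p Q ξ := by
  rw [antisym, antisym, hPQ ξ hξ, hPQ ξ⁻¹ (inv_ne_zero hξ)]

theorem theta_four_sub {p : ℂ} (hp : ‖p‖ < 1) {A B C D ξ : ℂ} (hA : A ≠ 0) (hB : B ≠ 0)
    (hC : C ≠ 0) (h1 : A * B * C * D = 1) (hξ : ξ ≠ 0) :
    theta p (A * ξ) * theta p (B * ξ) * theta p (C * ξ) * theta p (D * ξ)
      - ξ ^ 4 * (theta p (A * ξ⁻¹) * theta p (B * ξ⁻¹) * theta p (C * ξ⁻¹) * theta p (D * ξ⁻¹))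
      = D * ξ ^ 3 * theta p (ξ⁻¹ ^ 2) * (theta p (A * C) * theta p (B * C) * theta p (A * B)) := by
  have hD : D ≠ 0 := right_ne_zero_of_mul_eq_one h1
  -- The choice y² = A/B makes xy = Aξ and x/y = Bξ below; u and v are chosen so that uv = Cξ and
  -- u/v = Dξ. The other arguments appear inverted and are corrected by `theta_inv`.
  obtain ⟨y, hy⟩ := IsAlgClosed.exists_pow_nat_eq (A / B) two_pos
  have hy0 : y ≠ 0 := by
    rintro rfl
    exact div_ne_zero hA hB (by simpa using hy.symm)
  have hy2 : y ^ 2 * B = A := by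
    rw [hy]
    field_simp
  have H := theta_addition hp (x := y * B * ξ) (y := y) (u := y * ξ / A) (v := B * C * y)
    (by positivity) hy0 (by positivity) (by positivity)
  rw [show y * B * ξ * y = A * ξ by linear_combination ξ * hy2,
    show y * B * ξ / y = B * ξ by field_simp,
    show y * ξ / A * (B * C * y) = C * ξ by
      field_simp
      linear_combination hy2,
    show y * ξ / A / (B * C * y) = D * ξ by
      field_simp
      linear_combination -h1,
    show y * B * ξ * (B * C * y) = (D * ξ⁻¹)⁻¹ by
      rw [mul_inv, inv_inv]
      field_simp
      linear_combination B * C * D * hy2 + h1,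
    show y * B * ξ / (B * C * y) = (C * ξ⁻¹)⁻¹ by
      rw [mul_inv, inv_inv]
      field_simp,
    show y * ξ / A * y = (B * ξ⁻¹)⁻¹ by
      rw [mul_inv, inv_inv]
      field_simp
      linear_combination hy2,
    show y * ξ / A / y = (A * ξ⁻¹)⁻¹ by
      rw [mul_inv, inv_inv]
      field_simp,
    show y * (B * C * y) = A * C by linear_combination C * hy2,
    show y / (B * C * y) = (B * C)⁻¹ by field_simp,
    show y * B * ξ * (y * ξ / A) = (ξ⁻¹ ^ 2)⁻¹ by
      rw [inv_pow, inv_inv]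
      field_simp
      linear_combination hy2,
    show y * B * ξ / (y * ξ / A) = A * B by field_simp,
    theta_inv hp (by positivity), theta_inv hp (by positivity), theta_inv hp (by positivity),
    theta_inv hp (by positivity), theta_inv hp (by positivity), theta_inv hp (by positivity)] at H
  have hD' : D = (A * B * C)⁻¹ := eq_inv_of_mul_eq_one_right h1
  have e1 : ξ ^ 4 = (-(D * ξ⁻¹)⁻¹) * (-(C * ξ⁻¹)⁻¹) * ((-(B * ξ⁻¹)⁻¹) * (-(A * ξ⁻¹)⁻¹)) := by
    simp only [mul_inv, inv_inv]
    rw [hD']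
    field_simp
  have e2 : D * ξ ^ 3 = (A * ξ⁻¹)⁻¹ * ((-(B * C)⁻¹) * (-(ξ⁻¹ ^ 2)⁻¹)) := by
    simp only [mul_inv, inv_pow, inv_inv]
    rw [hD']
    field_simp
  rw [e1, e2]
  linear_combination H

/-- Four parameters with product one: the divided antisymmetrization is constant. -/
theorem antisym_four {p : ℂ} (hp : ‖p‖ < 1) {A B C D ξ : ℂ} (hA : A ≠ 0) (hB : B ≠ 0)
    (hC : C ≠ 0) (h1 : A * B * C * D = 1) (hξ : ξ ≠ 0) (hθ : theta p (ξ⁻¹ ^ 2) ≠ 0) :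
    antisym p (fun ξ => ξ⁻¹ ^ 2 *
        (theta p (A * ξ) * theta p (B * ξ) * theta p (C * ξ) * theta p (D * ξ))) ξ
      = D * (theta p (A * C) * theta p (B * C) * theta p (A * B)) := by
  have H := theta_four_sub hp hA hB hC h1 hξ
  rw [antisym, div_eq_iff (mul_ne_zero hξ hθ)]
  simp only [inv_inv]
  generalize theta p (A * ξ) * theta p (B * ξ) * theta p (C * ξ) * theta p (D * ξ) = L at *
  generalize theta p (A * ξ⁻¹) * theta p (B * ξ⁻¹) * theta p (C * ξ⁻¹) * theta p (D * ξ⁻¹) = R at *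
  generalize theta p (A * C) * theta p (B * C) * theta p (A * B) = E at *
  generalize theta p (ξ⁻¹ ^ 2) = T at *
  field_simp
  linear_combination H

/-! ### The difference operator on products h_k h_{N-k} -/

theorem h_inv (p q : ℂ) (k : ℕ) (a ξ : ℂ) : h p q k a ξ⁻¹ = h p q k a ξ := by
  rw [h, h, inv_inv, mul_comm]

theorem hh_inv (p q : ℂ) (N : ℕ) (a b : ℂ) (k : ℕ) (ξ : ℂ) :
    hh p q N a b k ξ⁻¹ = hh p q N a b k ξ := by
  simp only [hh, h_inv]

/-- Symmetry gives f(r⁻¹ξ) = f(rξ⁻¹), so the second term of Δ is the first with ξ inverted. -/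
theorem delta4_eq_antisym (p r a b c d : ℂ) {f : ℂ → ℂ} (hf : ∀ ξ, f ξ⁻¹ = f ξ) (ξ : ℂ) :
    delta4 p r a b c d f ξ = antisym p (fun ξ => ξ⁻¹ ^ 2 *
      (theta p (a * ξ) * theta p (b * ξ) * theta p (c * ξ) * theta p (d * ξ)) * f (r * ξ)) ξ := by
  rw [delta4, antisym, ← hf (r * ξ⁻¹)]
  simp only [mul_inv, inv_inv]

theorem theta_mul_ellPoch (p q a : ℂ) (k : ℕ) :
    theta p a * ellPoch p q (q * a) k = ellPoch p q a k * theta p (q ^ k * a) := by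
  have h1 := Finset.prod_range_succ (fun j => theta p (a * q ^ j)) k
  rw [Finset.prod_range_succ', pow_zero, mul_one] at h1
  rw [ellPoch, ellPoch, mul_comm (q ^ k), ← h1, mul_comm]
  congr 1
  exact Finset.prod_congr rfl fun j _ => by ring_nf

/-- The shift sends one argument of h to q·aξ and the other back to aξ⁻¹; θ(aξ) then restores the
missing first factor and frees the last one. -/
theorem theta_mul_h {p q r : ℂ} (hr0 : r ≠ 0) (hr : r ^ 2 = q) (k : ℕ) (a ξ : ℂ) :
    theta p (a * ξ) * h p q k (r * a) (r * ξ) = h p q k a ξ * theta p (q ^ k * a * ξ) := by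
  rw [h, h, show r * a * (r * ξ) = q * (a * ξ) by rw [← hr]; ring,
    show r * a * (r * ξ)⁻¹ = a * ξ⁻¹ by rw [mul_inv]; field_simp, ← mul_assoc,
    theta_mul_ellPoch, ← mul_assoc (q ^ k)]
  ring

/-- Without the matching shift of the parameter, a symmetric part of degree k survives, along with
the last factor of one factorial and the first factor of the other. -/
theorem h_succ_mul {p q r : ℂ} (hr0 : r ≠ 0) (hr : r ^ 2 = q) (k : ℕ) (l ξ : ℂ) :
    h p q (k + 1) l (r * ξ)
      = h p q k (r * l) ξ * (theta p (r * l * q ^ k * ξ) * theta p (l / r * ξ⁻¹)) := by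
  have e1 : l * (r * ξ)⁻¹ = l / r * ξ⁻¹ := by
    rw [mul_inv]
    ring
  have e2 : q * (l / r * ξ⁻¹) = r * l * ξ⁻¹ := by
    rw [← hr]
    field_simp
  have h1 : ellPoch p q (l / r * ξ⁻¹) (k + 1)
      = ellPoch p q (r * l * ξ⁻¹) k * theta p (l / r * ξ⁻¹) := by
    rw [ellPoch, Finset.prod_range_succ', pow_zero, mul_one, ellPoch, ← e2]
    congr 1
    exact Finset.prod_congr rfl fun j _ => by ring_nf
  have h2 : ellPoch p q (r * l * ξ) (k + 1)
      = ellPoch p q (r * l * ξ) k * theta p (r * l * q ^ k * ξ) := by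
    rw [ellPoch, Finset.prod_range_succ, ellPoch, mul_right_comm (r * l)]
  rw [h, h, e1, h1, show l * (r * ξ) = r * l * ξ by ring, h2]
  ring

theorem delta_hh {p q r : ℂ} (hp : ‖p‖ < 1) (hq : q ≠ 0) (hr : r ^ 2 = q) {N : ℕ} {a b c : ℂ}
    (ha : a ≠ 0) (hb : b ≠ 0) (hc : c ≠ 0) {k : ℕ} (hk : k ≤ N) {ξ : ℂ} (hξ : ξ ≠ 0)
    (hθ : theta p (ξ⁻¹ ^ 2) ≠ 0) :
    delta p q r N a b c (hh p q N (r * a) (r * b) k) ξ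
      = ((q ^ N)⁻¹ / (a * b * c) * (theta p (q ^ k * a * c) * theta p (q ^ (N - k) * b * c) *
          theta p (q ^ N * a * b))) * hh p q N a b k ξ := by
  have hr0 : r ≠ 0 := by
    rintro rfl
    exact hq (by simpa using hr.symm)
  have hN : q ^ k * q ^ (N - k) = q ^ N := by rw [← pow_add, Nat.add_sub_cancel' hk]
  rw [delta, delta4_eq_antisym _ _ _ _ _ _ (hh_inv p q N _ _ k)]
  have h1 := antisym_four hp (A := q ^ k * a) (B := q ^ (N - k) * b) (C := c)
    (D := (q ^ N)⁻¹ / (a * b * c)) (mul_ne_zero (pow_ne_zero _ hq) ha)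
    (mul_ne_zero (pow_ne_zero _ hq) hb) hc (by rw [← hN]; field_simp) hξ hθ
  rw [show q ^ k * a * (q ^ (N - k) * b) = q ^ N * a * b by rw [← hN]; ring] at h1
  rw [← h1, mul_comm (antisym _ _ _), ← antisym_mul_of_symm _ (hh_inv p q N a b k ξ)]
  congr 1
  funext η
  have h2 := theta_mul_h (p := p) hr0 hr k a η
  have h3 := theta_mul_h (p := p) hr0 hr (N - k) b η
  simp only [hh]
  linear_combination η⁻¹ ^ 2 * theta p (c * η) * theta p ((q ^ N)⁻¹ / (a * b * c) * η) *
    (theta p (b * η) * h p q (N - k) (r * b) (r * η) * h2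
      + h p q k a η * theta p (q ^ k * a * η) * h3)

/-! ### Antisymmetrization of products of six and eight theta functions -/

/-- The symmetric theta function `θ(Aξ^±;p)`. -/
noncomputable def symPair (p A ξ : ℂ) : ℂ := theta p (A * ξ) * theta p (A * ξ⁻¹)

theorem symPair_inv (p A ξ : ℂ) : symPair p A ξ⁻¹ = symPair p A ξ := by
  rw [symPair, symPair, inv_inv, mul_comm]

theorem theta_mul_inv_eq {p : ℂ} (hp : ‖p‖ < 1) {A ξ : ℂ} (hA : A ≠ 0) (hξ : ξ ≠ 0) :
    theta p (A⁻¹ * ξ) = -(A⁻¹ * ξ) * theta p (A * ξ⁻¹) := by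
  have h1 := theta_inv hp (mul_ne_zero hA (inv_ne_zero hξ))
  rwa [mul_inv, inv_inv] at h1

/-- The reduction step. The addition formula, with τ² = t₁t₂, expands θ(t₁ξ)θ(t₂ξ) in
θ(ξ/t₃)θ(t₁t₂t₃ξ) and θ(ξ/t₄)θ(t₁t₂t₄ξ); multiplying by θ(t₃ξ)θ(t₄ξ) completes a symmetric pair. Two
non-symmetric factors fewer remain, with the same parameter product. -/
theorem exists_theta_four_expand {p : ℂ} (hp : ‖p‖ < 1) {t₁ t₂ t₃ t₄ : ℂ} (h₁ : t₁ ≠ 0)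
    (h₂ : t₂ ≠ 0) (h₃ : t₃ ≠ 0) (h₄ : t₄ ≠ 0) (hn : theta p (t₁ * t₂ * t₃ * t₄) ≠ 0)
    (hd : theta p (t₃ / t₄) ≠ 0) :
    ∃ α β : ℂ, ∀ ξ, ξ ≠ 0 →
      theta p (t₁ * ξ) * theta p (t₂ * ξ) * theta p (t₃ * ξ) * theta p (t₄ * ξ)
        = α * (symPair p t₃ ξ * (ξ * (theta p (t₁ * t₂ * t₃ * ξ) * theta p (t₄ * ξ))))
          + β * (symPair p t₄ ξ * (ξ * (theta p (t₁ * t₂ * t₄ * ξ) * theta p (t₃ * ξ)))) := by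
  obtain ⟨τ, hτ⟩ := IsAlgClosed.exists_pow_nat_eq (t₁ * t₂) two_pos
  have hτ0 : τ ≠ 0 := by
    rintro rfl
    exact mul_ne_zero h₁ h₂ (by simpa using hτ.symm)
  have h0 : theta p (t₁ * t₂ * t₃ * t₄)⁻¹ ≠ 0 := by
    rw [theta_inv hp (by positivity)]
    exact mul_ne_zero (neg_ne_zero.mpr (by positivity)) hn
  set E := theta p (t₁ * t₂ * t₃ * t₄)⁻¹ * theta p (t₃ / t₄) with hE
  have hE0 : E ≠ 0 := mul_ne_zero h0 hd
  refine ⟨-(t₃⁻¹ * (theta p (t₂ * t₄)⁻¹ * theta p (t₁ * t₄)⁻¹) / E),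
    -(t₄⁻¹ * (t₁ * t₄)⁻¹ * (theta p (t₂ * t₃)⁻¹ * theta p (t₁ * t₃)) / E), fun ξ hξ => ?_⟩
  have H := theta_addition hp (x := τ * ξ) (y := t₁ / τ) (u := (t₄ * τ)⁻¹) (v := (t₃ * τ)⁻¹)
    (by positivity) (by positivity) (by positivity) (by positivity)
  rw [show τ * ξ * (t₁ / τ) = t₁ * ξ by field_simp,
    show τ * ξ / (t₁ / τ) = t₂ * ξ by
      field_simp
      linear_combination hτ,
    show (t₄ * τ)⁻¹ * (t₃ * τ)⁻¹ = (t₁ * t₂ * t₃ * t₄)⁻¹ by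
      rw [← hτ, ← mul_inv]
      ring_nf,
    show (t₄ * τ)⁻¹ / (t₃ * τ)⁻¹ = t₃ / t₄ by field_simp,
    show τ * ξ * (t₃ * τ)⁻¹ = t₃⁻¹ * ξ by field_simp,
    show τ * ξ / (t₃ * τ)⁻¹ = t₁ * t₂ * t₃ * ξ by
      rw [← hτ]
      field_simp,
    show (t₄ * τ)⁻¹ * (t₁ / τ) = (t₂ * t₄)⁻¹ by
      field_simp
      linear_combination -hτ,
    show (t₄ * τ)⁻¹ / (t₁ / τ) = (t₁ * t₄)⁻¹ by field_simp,
    show t₁ / τ * (t₃ * τ)⁻¹ = (t₂ * t₃)⁻¹ by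
      field_simp
      linear_combination -hτ,
    show t₁ / τ / (t₃ * τ)⁻¹ = t₁ * t₃ by field_simp,
    show τ * ξ * (t₄ * τ)⁻¹ = t₄⁻¹ * ξ by field_simp,
    show τ * ξ / (t₄ * τ)⁻¹ = t₁ * t₂ * t₄ * ξ by
      rw [← hτ]
      field_simp, theta_mul_inv_eq hp h₃ hξ, theta_mul_inv_eq hp h₄ hξ, ← hE] at H
  rw [symPair, symPair]
  have H2 := congrArg (fun z => z * (E⁻¹ * (theta p (t₃ * ξ) * theta p (t₄ * ξ)))) H
  linear_combination H2 - theta p (t₁ * ξ) * theta p (t₂ * ξ) * theta p (t₃ * ξ) *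
    theta p (t₄ * ξ) * mul_inv_cancel₀ hE0

/-- The addition formula with y = ξ: two pairs span all of them once the determinant θ(lm)θ(l/m) is
nonzero. -/
theorem exists_symPair_expand {p : ℂ} (hp : ‖p‖ < 1) {l m : ℂ} (hl : l ≠ 0) (hm : m ≠ 0)
    (hn : theta p (l * m) ≠ 0) (hd : theta p (l / m) ≠ 0) {A : ℂ} (hA : A ≠ 0) :
    ∃ α β : ℂ, ∀ ξ, ξ ≠ 0 → symPair p A ξ = α * symPair p l ξ + β * symPair p m ξ := by
  set E := theta p (l * m) * theta p (l / m) with hE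
  have hE0 : E ≠ 0 := mul_ne_zero hn hd
  refine ⟨theta p (A * m) * theta p (A / m) / E,
    -(l / m * (theta p (A * l) * theta p (A / l))) / E, fun ξ hξ => ?_⟩
  have H := theta_addition hp hA hξ hl hm
  rw [mul_comm ξ m, div_eq_inv_mul ξ m, theta_mul_inv_eq hp hm hξ, div_eq_mul_inv A ξ,
    div_eq_mul_inv l ξ, ← hE] at H
  simp only [symPair]
  have H2 := congrArg (fun z => z * E⁻¹) H
  have h3 := mul_inv_cancel₀ hξ
  linear_combination H2 - theta p (A * ξ) * theta p (A * ξ⁻¹) * mul_inv_cancel₀ hE0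
    - l / m * (theta p (A * l) * theta p (A / l)) / E * theta p (m * ξ) * theta p (m * ξ⁻¹) * h3

/-- Six parameters with product one: the divided antisymmetrization is linear. -/
theorem exists_antisym_six {p : ℂ} (hp : ‖p‖ < 1) {t₁ t₂ t₃ t₄ t₅ t₆ : ℂ} (h₁ : t₁ ≠ 0)
    (h₂ : t₂ ≠ 0) (h₃ : t₃ ≠ 0) (h₄ : t₄ ≠ 0) (h₅ : t₅ ≠ 0)
    (hprod : t₁ * t₂ * t₃ * t₄ * t₅ * t₆ = 1)
    (hn : theta p (t₁ * t₂ * t₃ * t₄) ≠ 0) (hd : theta p (t₃ / t₄) ≠ 0) :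
    ∃ α β : ℂ, ∀ ξ, ξ ≠ 0 → theta p (ξ⁻¹ ^ 2) ≠ 0 →
      antisym p (fun ξ => ξ⁻¹ ^ 3 * (theta p (t₁ * ξ) * theta p (t₂ * ξ) * theta p (t₃ * ξ) *
          theta p (t₄ * ξ) * theta p (t₅ * ξ) * theta p (t₆ * ξ))) ξ
        = α * symPair p t₃ ξ + β * symPair p t₄ ξ := by
  obtain ⟨α, β, H⟩ := exists_theta_four_expand hp h₁ h₂ h₃ h₄ hn hd
  have key : ∀ s t : ℂ, s ≠ 0 → t ≠ 0 → s * t * t₅ * t₆ = 1 → ∃ κ : ℂ, ∀ ξ, ξ ≠ 0 →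
      theta p (ξ⁻¹ ^ 2) ≠ 0 → antisym p (fun ξ => ξ⁻¹ ^ 2 * (theta p (s * ξ) *
        theta p (t * ξ) * theta p (t₅ * ξ) * theta p (t₆ * ξ))) ξ = κ :=
    fun s t hs ht hst => ⟨_, fun ξ hξ hθ => antisym_four hp hs ht h₅ hst hξ hθ⟩
  obtain ⟨κ, hκ⟩ := key (t₁ * t₂ * t₃) t₄ (by positivity) h₄ (by linear_combination hprod)
  obtain ⟨κ', hκ'⟩ := key (t₁ * t₂ * t₄) t₃ (by positivity) h₃ (by linear_combination hprod)
  refine ⟨α * κ, β * κ', fun ξ hξ hθ => ?_⟩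
  rw [antisym_congr (Q := fun ξ =>
    α * (symPair p t₃ ξ * (ξ⁻¹ ^ 2 * (theta p (t₁ * t₂ * t₃ * ξ) * theta p (t₄ * ξ) *
        theta p (t₅ * ξ) * theta p (t₆ * ξ))))
      + β * (symPair p t₄ ξ * (ξ⁻¹ ^ 2 * (theta p (t₁ * t₂ * t₄ * ξ) * theta p (t₃ * ξ) *
        theta p (t₅ * ξ) * theta p (t₆ * ξ))))) (fun η hη => ?_) hξ]
  · rw [antisym_add, antisym_const_mul, antisym_const_mul,
      antisym_mul_of_symm _ (symPair_inv p t₃ ξ), antisym_mul_of_symm _ (symPair_inv p t₄ ξ),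
      hκ ξ hξ hθ, hκ' ξ hξ hθ]
    ring
  · rw [H η hη]
    field_simp

/-- The points at which the divided antisymmetrization is defined. -/
def Regular (p : ℂ) : Set ℂ := {ξ | ξ ≠ 0 ∧ theta p (ξ⁻¹ ^ 2) ≠ 0}

/-- `symPair` as a function on the regular points. -/
noncomputable def symFun (p A : ℂ) : Regular p → ℂ := fun ξ => symPair p A ξ

/-- Eight parameters with product one: for generic parameters, the divided antisymmetrization is
quadratic. -/
theorem antisym_eight_mem {p : ℂ} (hp : ‖p‖ < 1) {M : Submodule ℂ (Regular p → ℂ)}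
    (hM : ∀ A B, A ≠ 0 → B ≠ 0 → symFun p A * symFun p B ∈ M)
    {a b c t₄ t₅ t₆ t₇ t₈ : ℂ} (ha : a ≠ 0) (hb : b ≠ 0) (hc : c ≠ 0) (h₄ : t₄ ≠ 0)
    (h₅ : t₅ ≠ 0) (h₆ : t₆ ≠ 0) (h₇ : t₇ ≠ 0)
    (hprod : a * b * c * t₄ * t₅ * t₆ * t₇ * t₈ = 1)
    (n₁ : theta p (b * c * t₄ * a) ≠ 0) (n₂ : theta p (t₄⁻¹ * a) ≠ 0)
    (n₃ : theta p (b * c * t₄ * t₅ * t₆ * a) ≠ 0) (n₄ : theta p (b * c * t₄⁻¹ * a) ≠ 0)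
    (n₅ : theta p ((b * c * t₄)⁻¹ * a) ≠ 0) :
    (fun ξ : Regular p => antisym p (fun ξ => ξ⁻¹ ^ 4 * (theta p (a * ξ) * theta p (b * ξ) *
      theta p (c * ξ) * theta p (t₄ * ξ) * theta p (t₅ * ξ) * theta p (t₆ * ξ) *
      theta p (t₇ * ξ) * theta p (t₈ * ξ))) ξ) ∈ M := by
  -- Each of the two terms is a symmetric pair times a six-parameter product. All nonvanishing
  -- conditions have the form θ(κa) ≠ 0, so they exclude only countably many a.
  obtain ⟨α, β, H⟩ := exists_theta_four_expand hp hb hc ha h₄ (by convert n₁ using 2; ring)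
    (by convert n₂ using 2; ring)
  obtain ⟨α₁, β₁, H₁⟩ := exists_antisym_six hp (t₁ := t₅) (t₂ := t₆) (t₃ := b * c * a)
    (t₄ := t₄) (t₅ := t₇) (t₆ := t₈) h₅ h₆ (by positivity) h₄ h₇
    (by linear_combination hprod) (by convert n₃ using 2; ring) (by convert n₄ using 2; ring)
  obtain ⟨α₂, β₂, H₂⟩ := exists_antisym_six hp (t₁ := t₅) (t₂ := t₆) (t₃ := a)
    (t₄ := b * c * t₄) (t₅ := t₇) (t₆ := t₈) h₅ h₆ ha (by positivity) h₇
    (by linear_combination hprod) (by convert n₃ using 2; ring) (by convert n₅ using 2; ring)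
  have hmem : α • (α₁ • (symFun p a * symFun p (b * c * a)) + β₁ • (symFun p a * symFun p t₄))
      + β • (α₂ • (symFun p t₄ * symFun p a) + β₂ • (symFun p t₄ * symFun p (b * c * t₄)))
      ∈ M := by
    refine M.add_mem (M.smul_mem _ (M.add_mem ?_ ?_)) (M.smul_mem _ (M.add_mem ?_ ?_)) <;>
      exact M.smul_mem _ (hM _ _ (by positivity) (by positivity))
  convert hmem using 1
  funext ⟨ξ, hξ, hθ⟩
  simp only [Pi.add_apply, Pi.smul_apply, Pi.mul_apply, smul_eq_mul, symFun]
  rw [antisym_congr (Q := fun ξ =>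
    α * (symPair p a ξ * (ξ⁻¹ ^ 3 * (theta p (t₅ * ξ) * theta p (t₆ * ξ) *
        theta p (b * c * a * ξ) * theta p (t₄ * ξ) * theta p (t₇ * ξ) * theta p (t₈ * ξ))))
      + β * (symPair p t₄ ξ * (ξ⁻¹ ^ 3 * (theta p (t₅ * ξ) * theta p (t₆ * ξ) *
        theta p (a * ξ) * theta p (b * c * t₄ * ξ) * theta p (t₇ * ξ) * theta p (t₈ * ξ)))))
      (fun η hη => ?_) hξ]
  · rw [antisym_add, antisym_const_mul, antisym_const_mul,
      antisym_mul_of_symm _ (symPair_inv p a ξ), antisym_mul_of_symm _ (symPair_inv p t₄ ξ),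
      H₁ ξ hξ hθ, H₂ ξ hξ hθ]
    ring
  · have h1 := H η hη
    have h2 : η⁻¹ ^ 4 * η = η⁻¹ ^ 3 := by field_simp
    rw [← h2]
    linear_combination η⁻¹ ^ 4 * theta p (t₅ * η) * theta p (t₆ * η) * theta p (t₇ * η) *
      theta p (t₈ * η) * h1

/-- Expand both factors in the pairs of l₁ and m₁. The mixed term is allowed; in the square of the
l₁ pair one copy is rewritten through l₂ and m₁, and in the square of the m₁ pair through l₁ and m₂.
-/
theorem symFun_mul_mem_span {p : ℂ} (hp : ‖p‖ < 1) {l₁ l₂ m₁ m₂ : ℂ} (hl₁ : l₁ ≠ 0)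
    (hl₂ : l₂ ≠ 0) (hm₁ : m₁ ≠ 0) (hm₂ : m₂ ≠ 0)
    (n₁₁ : theta p (l₁ * m₁) ≠ 0) (d₁₁ : theta p (l₁ / m₁) ≠ 0)
    (n₁₂ : theta p (l₁ * m₂) ≠ 0) (d₁₂ : theta p (l₁ / m₂) ≠ 0)
    (n₂₁ : theta p (l₂ * m₁) ≠ 0) (d₂₁ : theta p (l₂ / m₁) ≠ 0) {A B : ℂ} (hA : A ≠ 0)
    (hB : B ≠ 0) :
    symFun p A * symFun p B ∈ Submodule.span ℂ {symFun p m₁ * symFun p m₂,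
      symFun p l₁ * symFun p m₁, symFun p l₁ * symFun p l₂} := by
  have key : ∀ {l m A : ℂ}, l ≠ 0 → m ≠ 0 → A ≠ 0 → theta p (l * m) ≠ 0 → theta p (l / m) ≠ 0 →
      ∃ α β : ℂ, symFun p A = α • symFun p l + β • symFun p m := by
    intro l m A hl hm hA hn hd
    obtain ⟨α, β, H⟩ := exists_symPair_expand hp hl hm hn hd hA
    exact ⟨α, β, funext fun ξ => H ξ ξ.2.1⟩
  obtain ⟨α, β, hA⟩ := key hl₁ hm₁ hA n₁₁ d₁₁
  obtain ⟨γ, δ, hB⟩ := key hl₁ hm₁ hB n₁₁ d₁₁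
  obtain ⟨ε, ζ, h1⟩ := key hl₂ hm₁ hl₁ n₂₁ d₂₁
  obtain ⟨η, θ, h2⟩ := key hl₁ hm₂ hm₁ n₁₂ d₁₂
  rw [Submodule.mem_span_triple]
  refine ⟨β * δ * θ, α * δ + β * γ + α * γ * ζ + β * δ * η, α * γ * ε, funext fun ξ => ?_⟩
  have hA := congrFun hA ξ
  have hB := congrFun hB ξ
  have h1 := congrFun h1 ξ
  have h2 := congrFun h2 ξ
  simp only [Pi.add_apply, Pi.smul_apply, Pi.mul_apply, smul_eq_mul] at *
  rw [hA, hB]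
  linear_combination -α * γ * symFun p l₁ ξ * h1 - β * δ * symFun p m₁ ξ * h2

/-! ### Removing the genericity conditions -/

/-- A finite-dimensional subspace is closed for pointwise convergence, and the complement of a
countable set is dense in ℂ. -/
theorem mem_of_countable_exceptions {X : Type*} (M : Submodule ℂ (X → ℂ))
    [FiniteDimensional ℂ M] {F : ℂ → X → ℂ} (hF : ∀ a, a ≠ 0 → ContinuousAt F a) {S : Set ℂ}
    (hS : S.Countable) (h : ∀ a, a ≠ 0 → a ∉ S → F a ∈ M) {a : ℂ} (ha : a ≠ 0) : F a ∈ M := by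
  have hd : Dense (insert 0 S)ᶜ := (hS.insert 0).dense_compl ℂ
  have hc : IsClosed (M : Set (X → ℂ)) := M.closed_of_finiteDimensional
  have h1 := (hF a ha).continuousWithinAt.mem_closure_image (hd a)
  refine hc.closure_subset_iff.mpr ?_ h1
  rintro _ ⟨z, hz, rfl⟩
  rw [Set.mem_compl_iff, Set.mem_insert_iff, not_or] at hz
  exact h z hz.1 hz.2

theorem continuousAt_antisym {p : ℂ} {P : ℂ → ℂ → ℂ} {a : ℂ}
    (hP : ∀ ξ, ξ ≠ 0 → ContinuousAt (fun a => P a ξ) a) :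
    ContinuousAt (fun a (ξ : Regular p) => antisym p (P a) ξ) a := by
  rw [continuousAt_pi]
  rintro ⟨ξ, hξ, -⟩
  exact ((hP ξ hξ).sub (hP ξ⁻¹ (inv_ne_zero hξ))).div_const _

theorem continuousAt_theta_comp {p : ℂ} (hp : ‖p‖ < 1) {f : ℂ → ℂ} {a : ℂ}
    (hf : ContinuousAt f a) (h0 : f a ≠ 0) : ContinuousAt (fun a => theta p (f a)) a :=
  ContinuousAt.comp (f := f) (continuousAt_theta hp h0) hf

/-- Eight parameters with product one: the divided antisymmetrization is quadratic. -/
theorem antisym_eight_mem_of_prod {p : ℂ} (hp : ‖p‖ < 1) {M : Submodule ℂ (Regular p → ℂ)}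
    [FiniteDimensional ℂ M] (hM : ∀ A B, A ≠ 0 → B ≠ 0 → symFun p A * symFun p B ∈ M)
    {a b c d t₄ t₅ t₆ t₇ : ℂ} (ha : a ≠ 0) (hb : b ≠ 0) (hc : c ≠ 0) (hd : d ≠ 0) (h₄ : t₄ ≠ 0)
    (h₅ : t₅ ≠ 0) (h₆ : t₆ ≠ 0) (h₇ : t₇ ≠ 0)
    (hprod : a * b * c * d * t₄ * t₅ * t₆ * t₇ = 1) :
    (fun ξ : Regular p => antisym p (fun ξ => ξ⁻¹ ^ 4 * (theta p (a * ξ) * theta p (b * ξ) *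
      theta p (c * ξ) * theta p (t₄ * ξ) * theta p (t₅ * ξ) * theta p (t₆ * ξ) *
      theta p (t₇ * ξ) * theta p (d * ξ))) ξ) ∈ M := by
  -- Keeping ad = κ fixed lets a vary while the product of the eight parameters stays 1.
  obtain ⟨κ, hκ⟩ : ∃ κ, κ = a * d := ⟨_, rfl⟩
  have hκ0 : κ ≠ 0 := hκ ▸ mul_ne_zero ha hd
  have hdκ : d = κ / a := by
    rw [hκ]
    field_simp
  rw [hdκ]
  have hF : ∀ a : ℂ, a ≠ 0 → ContinuousAt (fun a (ξ : Regular p) => antisym p (fun ξ =>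
      ξ⁻¹ ^ 4 * (theta p (a * ξ) * theta p (b * ξ) *
      theta p (c * ξ) * theta p (t₄ * ξ) * theta p (t₅ * ξ) * theta p (t₆ * ξ) *
      theta p (t₇ * ξ) * theta p (κ / a * ξ))) ξ) a := by
    intro a ha
    refine continuousAt_antisym fun ξ hξ => ?_
    have h1 : ContinuousAt (fun a => theta p (a * ξ)) a :=
      continuousAt_theta_comp hp (continuousAt_id.mul_const ξ) (mul_ne_zero ha hξ)
    have h2 : ContinuousAt (fun a => theta p (κ / a * ξ)) a :=
      continuousAt_theta_comp hp ((continuousAt_const.div continuousAt_id ha).mul_const ξ)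
        (mul_ne_zero (div_ne_zero hκ0 ha) hξ)
    fun_prop
  refine mem_of_countable_exceptions M hF
    (((((countable_theta_zeros hp (κ := b * c * t₄) (by positivity)).union
      (countable_theta_zeros hp (κ := t₄⁻¹) (by positivity))).union
      (countable_theta_zeros hp (κ := b * c * t₄ * t₅ * t₆) (by positivity))).union
      (countable_theta_zeros hp (κ := b * c * t₄⁻¹) (by positivity))).union
      (countable_theta_zeros hp (κ := (b * c * t₄)⁻¹) (by positivity))) (fun z hz hS => ?_) ha
  simp only [Set.mem_union, Set.mem_ofPred_eq, not_or, not_and] at hS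
  obtain ⟨⟨⟨⟨n₁, n₂⟩, n₃⟩, n₄⟩, n₅⟩ := hS
  refine antisym_eight_mem hp hM hz hb hc h₄ h₅ h₆ h₇ ?_ (n₁ hz) (n₂ hz) (n₃ hz) (n₄ hz) (n₅ hz)
  rw [hκ]
  field_simp
  linear_combination hprod

/-- Six parameters with product one: the divided antisymmetrization is linear. -/
theorem antisym_six_mem_of_prod {p : ℂ} (hp : ‖p‖ < 1) {M : Submodule ℂ (Regular p → ℂ)}
    [FiniteDimensional ℂ M] (hM : ∀ A, A ≠ 0 → symFun p A ∈ M)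
    {a b c d t₄ t₅ : ℂ} (ha : a ≠ 0) (hb : b ≠ 0) (hc : c ≠ 0) (hd : d ≠ 0) (h₄ : t₄ ≠ 0)
    (h₅ : t₅ ≠ 0) (hprod : a * b * c * d * t₄ * t₅ = 1) :
    (fun ξ : Regular p => antisym p (fun ξ => ξ⁻¹ ^ 3 * (theta p (b * ξ) * theta p (c * ξ) *
      theta p (a * ξ) * theta p (t₄ * ξ) * theta p (t₅ * ξ) * theta p (d * ξ))) ξ) ∈ M := by
  obtain ⟨κ, hκ⟩ : ∃ κ, κ = a * d := ⟨_, rfl⟩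
  have hκ0 : κ ≠ 0 := hκ ▸ mul_ne_zero ha hd
  have hdκ : d = κ / a := by
    rw [hκ]
    field_simp
  rw [hdκ]
  have hF : ∀ a : ℂ, a ≠ 0 → ContinuousAt (fun a (ξ : Regular p) => antisym p (fun ξ =>
      ξ⁻¹ ^ 3 * (theta p (b * ξ) * theta p (c * ξ) *
      theta p (a * ξ) * theta p (t₄ * ξ) * theta p (t₅ * ξ) * theta p (κ / a * ξ))) ξ) a := by
    intro a ha
    refine continuousAt_antisym fun ξ hξ => ?_
    have h1 : ContinuousAt (fun a => theta p (a * ξ)) a :=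
      continuousAt_theta_comp hp (continuousAt_id.mul_const ξ) (mul_ne_zero ha hξ)
    have h2 : ContinuousAt (fun a => theta p (κ / a * ξ)) a :=
      continuousAt_theta_comp hp ((continuousAt_const.div continuousAt_id ha).mul_const ξ)
        (mul_ne_zero (div_ne_zero hκ0 ha) hξ)
    fun_prop
  refine mem_of_countable_exceptions M hF
    ((countable_theta_zeros hp (κ := b * c * t₄) (by positivity)).union
      (countable_theta_zeros hp (κ := t₄⁻¹) (by positivity))) (fun z hz hS => ?_) ha
  simp only [Set.mem_union, Set.mem_ofPred_eq, not_or, not_and] at hS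
  obtain ⟨n₁, n₂⟩ := hS
  obtain ⟨α, β, H⟩ := exists_antisym_six hp hb hc hz h₄ h₅ (t₆ := κ / z)
    (by
      rw [hκ]
      field_simp
      linear_combination hprod)
    (by convert n₁ hz using 2; ring) (by convert n₂ hz using 2; ring)
  convert M.add_mem (M.smul_mem α (hM z hz)) (M.smul_mem β (hM t₄ h₄)) using 1
  exact funext fun ξ => H ξ ξ.2.1 ξ.2.2

/-! ### The tridiagonal action of the difference operator -/

theorem theta_ne_zero_of_nonresonant {p q : ℂ} (hp : ‖p‖ < 1) (hq : q ≠ 0) {N : ℕ} {a b : ℂ}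
    (ha : a ≠ 0) (hb : b ≠ 0) (hN : Nonresonant p q N a b) {i j : ℕ} (hij : i + j + 1 ≤ N) :
    theta p (a * q ^ i * (b * q ^ j)) ≠ 0 ∧ theta p (a * q ^ i / (b * q ^ j)) ≠ 0 := by
  constructor
  · intro h0
    obtain ⟨m, hm⟩ := exists_of_theta_eq_zero hp (by positivity) h0
    refine hN.2 m (-((i : ℤ) + j)) (by omega) (by omega) ?_
    rw [zpow_neg, zpow_add₀ hq, zpow_natCast, zpow_natCast]
    refine eq_inv_of_mul_eq_one_left ?_
    linear_combination hm
  · intro h0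
    obtain ⟨m, hm⟩ := exists_of_theta_eq_zero hp (by positivity) h0
    refine hN.1 m ((j : ℤ) - i) (by omega) (by omega) ?_
    rw [zpow_sub₀ hq, zpow_natCast, zpow_natCast]
    have h1 : q ^ i * q ^ j ≠ 0 := by positivity
    field_simp at hm ⊢
    linear_combination hm

theorem h_succ_eq (p q : ℂ) (k : ℕ) (a ξ : ℂ) :
    h p q (k + 1) a ξ = h p q k a ξ * symPair p (a * q ^ k) ξ := by
  rw [h, h, symPair, ellPoch, ellPoch, Finset.prod_range_succ, Finset.prod_range_succ, ellPoch,
    ellPoch, mul_right_comm a, mul_right_comm a]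
  ring_nf

theorem h_zero_eq (p q a ξ : ℂ) : h p q 0 a ξ = 1 := by
  simp [h, ellPoch]

theorem hh_swap (p q : ℂ) {N : ℕ} (a b : ℂ) {k : ℕ} (hk : k ≤ N) :
    hh p q N a b k = hh p q N b a (N - k) := by
  funext ξ
  simp only [hh]
  rw [Nat.sub_sub_self hk, mul_comm]

/-- The indices k + 1 and n + 1 are positive, so `h_succ_mul` applies to both factors and gives four
theta functions beyond those of Δ. -/
theorem exists_delta_hh_interior {p q r : ℂ} (hp : ‖p‖ < 1) (hq : q ≠ 0) (hr : r ^ 2 = q)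
    {a b c l m : ℂ} (ha : a ≠ 0) (hb : b ≠ 0) (hc : c ≠ 0) (hl : l ≠ 0) (hm : m ≠ 0) {k n : ℕ}
    (hN : Nonresonant p q (k + n + 2) (r * l) (r * m)) :
    ∃ α β γ : ℂ, ∀ ξ, ξ ≠ 0 → theta p (ξ⁻¹ ^ 2) ≠ 0 →
      delta p q r (k + n + 2) a b c (hh p q (k + n + 2) l m (k + 1)) ξ
        = α * hh p q (k + n + 2) (r * l) (r * m) k ξ
          + β * hh p q (k + n + 2) (r * l) (r * m) (k + 1) ξ
          + γ * hh p q (k + n + 2) (r * l) (r * m) (k + 2) ξ := by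
  have hr0 : r ≠ 0 := by
    rintro rfl
    exact hq (by simpa using hr.symm)
  have hrl : r * l ≠ 0 := mul_ne_zero hr0 hl
  have hrm : r * m ≠ 0 := mul_ne_zero hr0 hm
  have nr := fun {i j : ℕ} => theta_ne_zero_of_nonresonant hp hq hrl hrm hN (i := i) (j := j)
  obtain ⟨n₁₁, d₁₁⟩ := nr (i := k) (j := n) (by omega)
  obtain ⟨n₁₂, d₁₂⟩ := nr (i := k) (j := n + 1) (by omega)
  obtain ⟨n₂₁, d₂₁⟩ := nr (i := k + 1) (j := n) (by omega)
  have hM := fun A B (hA : A ≠ 0) (hB : B ≠ 0) => symFun_mul_mem_span hp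
    (l₁ := r * l * q ^ k) (l₂ := r * l * q ^ (k + 1)) (m₁ := r * m * q ^ n)
    (m₂ := r * m * q ^ (n + 1)) (by positivity) (by positivity) (by positivity)
    (by positivity) n₁₁ d₁₁ n₁₂ d₁₂ n₂₁ d₂₁ hA hB
  have : FiniteDimensional ℂ (Submodule.span ℂ
      {symFun p (r * m * q ^ n) * symFun p (r * m * q ^ (n + 1)),
        symFun p (r * l * q ^ k) * symFun p (r * m * q ^ n),
        symFun p (r * l * q ^ k) * symFun p (r * l * q ^ (k + 1))}) :=
    FiniteDimensional.span_of_finite ℂ (Set.toFinite _)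
  have hd : (q ^ (k + n + 2))⁻¹ / (a * b * c) ≠ 0 := by positivity
  have hmem := antisym_eight_mem_of_prod hp hM ha hb hc hd (t₄ := r / l)
    (t₅ := r * l * q ^ k) (t₆ := r / m) (t₇ := r * m * q ^ n) (by positivity) (by positivity)
    (by positivity) (by positivity)
    (by
      rw [← hr]
      field_simp
      ring)
  obtain ⟨α, β, γ, H⟩ := Submodule.mem_span_triple.mp hmem
  -- The prefactor, and the change from ξ⁻² to ξ⁻⁴, come from inverting θ(lξ⁻¹/r) and θ(mξ⁻¹/r).
  refine ⟨l / r * (m / r) * α, l / r * (m / r) * β, l / r * (m / r) * γ, fun ξ hξ hθ => ?_⟩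
  have H := congrFun H ⟨ξ, hξ, hθ⟩
  simp only [Pi.add_apply, Pi.smul_apply, Pi.mul_apply, smul_eq_mul, symFun] at H
  rw [delta, delta4_eq_antisym _ _ _ _ _ _ (hh_inv p q _ l m _)]
  have hS : h p q k (r * l) ξ⁻¹ * h p q n (r * m) ξ⁻¹
      = h p q k (r * l) ξ * h p q n (r * m) ξ := by rw [h_inv, h_inv]
  rw [antisym_congr (Q := fun ξ => h p q k (r * l) ξ * h p q n (r * m) ξ *
    (l / r * (m / r) * (ξ⁻¹ ^ 4 * (theta p (a * ξ) * theta p (b * ξ) *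
      theta p (c * ξ) * theta p (r / l * ξ) * theta p (r * l * q ^ k * ξ) * theta p (r / m * ξ) *
      theta p (r * m * q ^ n * ξ) * theta p ((q ^ (k + n + 2))⁻¹ / (a * b * c) * ξ)))))
      (fun η hη => ?_) hξ,
    antisym_mul_of_symm (S := fun ξ => h p q k (r * l) ξ * h p q n (r * m) ξ) _ hS,
    antisym_const_mul, ← H]
  · simp only [hh]
    rw [show k + n + 2 - k = n + 1 + 1 by omega, show k + n + 2 - (k + 1) = n + 1 by omega,
      show k + n + 2 - (k + 2) = n by omega]
    simp only [h_succ_eq]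
    ring
  · simp only [hh]
    rw [show k + n + 2 - (k + 1) = n + 1 by omega, h_succ_mul hr0 hr, h_succ_mul hr0 hr,
      ← inv_div r l, ← inv_div r m]
    have e1 := theta_mul_inv_eq hp (A := (r / l)⁻¹) (ξ := η) (by positivity) hη
    have e2 := theta_mul_inv_eq hp (A := (r / m)⁻¹) (ξ := η) (by positivity) hη
    rw [inv_inv] at e1 e2
    rw [e1, e2]
    field_simp

/-- Only one h is nontrivial, so six theta functions remain. Assuming just two nonvanishing values
lets the lemma also serve k = N, with l and m exchanged. -/
theorem exists_delta_hh_zero {p q r : ℂ} (hp : ‖p‖ < 1) (hq : q ≠ 0) (hr : r ^ 2 = q)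
    {a b c l m : ℂ} (ha : a ≠ 0) (hb : b ≠ 0) (hc : c ≠ 0) (hl : l ≠ 0) (hm : m ≠ 0) {n : ℕ}
    (hN : theta p (r * l * (r * m * q ^ n)) ≠ 0) (hD : theta p (r * l / (r * m * q ^ n)) ≠ 0) :
    ∃ α β : ℂ, ∀ ξ, ξ ≠ 0 → theta p (ξ⁻¹ ^ 2) ≠ 0 →
      delta p q r (n + 1) a b c (hh p q (n + 1) l m 0) ξ
        = α * hh p q (n + 1) (r * l) (r * m) 0 ξ + β * hh p q (n + 1) (r * l) (r * m) 1 ξ := by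
  have hr0 : r ≠ 0 := by
    rintro rfl
    exact hq (by simpa using hr.symm)
  have hrl : r * l ≠ 0 := mul_ne_zero hr0 hl
  have hrm : r * m ≠ 0 := mul_ne_zero hr0 hm
  have hM : ∀ A, A ≠ 0 → symFun p A ∈
      Submodule.span ℂ {symFun p (r * l), symFun p (r * m * q ^ n)} := by
    intro A hA
    obtain ⟨α, β, H⟩ := exists_symPair_expand hp hrl (by positivity) hN hD hA
    exact Submodule.mem_span_pair.mpr ⟨α, β, funext fun ξ => (H ξ ξ.2.1).symm⟩
  have : FiniteDimensional ℂ (Submodule.span ℂ {symFun p (r * l), symFun p (r * m * q ^ n)}) :=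
    FiniteDimensional.span_of_finite ℂ (Set.toFinite _)
  have hd : (q ^ (n + 1))⁻¹ / (a * b * c) ≠ 0 := by positivity
  have hmem := antisym_six_mem_of_prod hp hM ha hb hc hd (t₄ := r / m)
    (t₅ := r * m * q ^ n) (by positivity) (by positivity)
    (by
      rw [← hr]
      field_simp
      ring)
  obtain ⟨α, β, H⟩ := Submodule.mem_span_pair.mp hmem
  refine ⟨-(m / r) * β, -(m / r) * α, fun ξ hξ hθ => ?_⟩
  have H := congrFun H ⟨ξ, hξ, hθ⟩
  simp only [Pi.add_apply, Pi.smul_apply, smul_eq_mul, symFun] at H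
  rw [delta, delta4_eq_antisym _ _ _ _ _ _ (hh_inv p q _ l m _)]
  rw [antisym_congr (Q := fun ξ => h p q n (r * m) ξ *
    (-(m / r) * (ξ⁻¹ ^ 3 * (theta p (b * ξ) * theta p (c * ξ) * theta p (a * ξ) *
      theta p (r / m * ξ) * theta p (r * m * q ^ n * ξ) *
      theta p ((q ^ (n + 1))⁻¹ / (a * b * c) * ξ))))) (fun η hη => ?_) hξ,
    antisym_mul_of_symm _ (h_inv p q n (r * m) ξ), antisym_const_mul, ← H]
  · simp only [hh]
    rw [show n + 1 - 0 = n + 1 by omega, show n + 1 - 1 = n by omega, ← zero_add 1]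
    simp only [h_succ_eq, h_zero_eq, pow_zero, mul_one]
    ring
  · simp only [hh]
    rw [show n + 1 - 0 = n + 1 by omega, h_succ_mul hr0 hr, h_zero_eq, ← inv_div r m]
    have e1 := theta_mul_inv_eq hp (A := (r / m)⁻¹) (ξ := η) (by positivity) hη
    rw [inv_inv] at e1
    rw [e1]
    field_simp

end EllipticSixJ

/-! ### The three statements -/

theorem mainTheorem4 (p q r : ℂ) (hp : ‖p‖ < 1) (hq : q ≠ 0) (hr : r ^ 2 = q) (N : ℕ)
    (a b c : ℂ) (ha : a ≠ 0) (hb : b ≠ 0) (hc : c ≠ 0) :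
    (∀ k : ℕ, k ≤ N →
      EllipticSixJ.EqRegular p
        (EllipticSixJ.delta p q r N a b c (EllipticSixJ.hh p q N (r * a) (r * b) k))
        (((q ^ N)⁻¹ / (a * b * c) *
            (EllipticSixJ.theta p (q ^ k * a * c) * EllipticSixJ.theta p (q ^ (N - k) * b * c) *
              EllipticSixJ.theta p (q ^ N * a * b))) •
          EllipticSixJ.hh p q N a b k)) ∧
    (∀ c' : ℂ, c' ≠ 0 → ∀ k : ℕ, k ≤ N →
      EllipticSixJ.EqRegular p
        ((c * (EllipticSixJ.theta p (q ^ k * a * c') *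
              EllipticSixJ.theta p (q ^ (N - k) * b * c'))) •
          EllipticSixJ.delta p q r N a b c (EllipticSixJ.hh p q N (r * a) (r * b) k))
        ((c' * (EllipticSixJ.theta p (q ^ k * a * c) *
              EllipticSixJ.theta p (q ^ (N - k) * b * c))) •
          EllipticSixJ.delta p q r N a b c' (EllipticSixJ.hh p q N (r * a) (r * b) k))) ∧
    (∀ l m : ℂ, l ≠ 0 → m ≠ 0 → EllipticSixJ.Nonresonant p q N (r * l) (r * m) →
      ∀ k : ℕ, k ≤ N →
        ∃ g ∈ Submodule.span ℂ {f : ℂ → ℂ | ∃ j : ℕ, j ≤ N ∧ k ≤ j + 1 ∧ j ≤ k + 1 ∧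
            f = EllipticSixJ.hh p q N (r * l) (r * m) j},
          EllipticSixJ.EqRegular p
            (EllipticSixJ.delta p q r N a b c (EllipticSixJ.hh p q N l m k)) g) := by
  have hr0 : r ≠ 0 := by
    rintro rfl
    exact hq (by simpa using hr.symm)
  refine ⟨fun k hk ξ hξ hθ => ?_, fun c' hc' k hk ξ hξ hθ => ?_, fun l m hl hm hN k hk => ?_⟩
  · exact EllipticSixJ.delta_hh hp hq hr ha hb hc hk hξ hθ
  -- The product of c with the prefactor q^{-N}/(abc) is independent of c, so both sides agree after
  -- (i).
  · rw [Pi.smul_apply, Pi.smul_apply, EllipticSixJ.delta_hh hp hq hr ha hb hc hk hξ hθ,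
      EllipticSixJ.delta_hh hp hq hr ha hb hc' hk hξ hθ, smul_eq_mul, smul_eq_mul]
    field_simp
  · have mem : ∀ (α : ℂ) (j : ℕ), j ≤ N → k ≤ j + 1 → j ≤ k + 1 →
        α • EllipticSixJ.hh p q N (r * l) (r * m) j ∈
          Submodule.span ℂ {f : ℂ → ℂ | ∃ j : ℕ, j ≤ N ∧ k ≤ j + 1 ∧ j ≤ k + 1 ∧
            f = EllipticSixJ.hh p q N (r * l) (r * m) j} := fun α j h1 h2 h3 =>
      Submodule.smul_mem _ _ (Submodule.subset_span ⟨j, h1, h2, h3, rfl⟩)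
    have hrl : r * l ≠ 0 := mul_ne_zero hr0 hl
    have hrm : r * m ≠ 0 := mul_ne_zero hr0 hm
    -- For N = 0 all the products are the constant 1, and (i) already gives the scalar.
    rcases Nat.eq_zero_or_pos N with rfl | hNpos
    · obtain rfl : k = 0 := by omega
      refine ⟨_, mem ((q ^ 0)⁻¹ / (a * b * c) * (EllipticSixJ.theta p (q ^ 0 * a * c) *
        EllipticSixJ.theta p (q ^ (0 - 0) * b * c) * EllipticSixJ.theta p (q ^ 0 * a * b)))
        0 le_rfl (by omega) (by omega), fun ξ hξ hθ => ?_⟩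
      have hconst : ∀ a b a' b' : ℂ,
          EllipticSixJ.hh p q 0 a b 0 = EllipticSixJ.hh p q 0 a' b' 0 := fun _ _ _ _ => by
        funext η
        simp only [EllipticSixJ.hh, Nat.sub_zero, EllipticSixJ.h_zero_eq]
      rw [hconst l m (r * a) (r * b), EllipticSixJ.delta_hh hp hq hr ha hb hc le_rfl hξ hθ,
        hconst a b (r * l) (r * m), Pi.smul_apply, smul_eq_mul]
    rcases Nat.eq_zero_or_pos k with rfl | hkpos
    · obtain ⟨n, rfl⟩ := Nat.exists_eq_succ_of_ne_zero hNpos.ne'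
      obtain ⟨h1, h2⟩ := EllipticSixJ.theta_ne_zero_of_nonresonant hp hq hrl hrm hN
        (i := 0) (j := n) (by omega)
      rw [pow_zero, mul_one] at h1 h2
      obtain ⟨α, β, H⟩ := EllipticSixJ.exists_delta_hh_zero hp hq hr ha hb hc hl hm h1 h2
      exact ⟨_, Submodule.add_mem _ (mem α 0 (by omega) (by omega) (by omega))
        (mem β 1 (by omega) (by omega) (by omega)), H⟩
    rcases hk.eq_or_lt with rfl | hkN
    -- The case k = N is the case k = 0 with l and m exchanged; Δ itself does not involve them.
    · obtain ⟨n, rfl⟩ := Nat.exists_eq_succ_of_ne_zero hNpos.ne'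
      obtain ⟨h1, h2⟩ := EllipticSixJ.theta_ne_zero_of_nonresonant hp hq hrl hrm hN
        (i := n) (j := 0) (by omega)
      rw [pow_zero, mul_one] at h1 h2
      have h3 : EllipticSixJ.theta p (r * m / (r * l * q ^ n)) ≠ 0 := by
        rw [← inv_div, EllipticSixJ.theta_inv hp (by positivity)]
        exact mul_ne_zero (neg_ne_zero.mpr (by positivity)) h2
      obtain ⟨α, β, H⟩ := EllipticSixJ.exists_delta_hh_zero hp hq hr ha hb hc hm hl
        (by rwa [mul_comm]) h3
      refine ⟨_, Submodule.add_mem _ (mem α (n + 1) (by omega) (by omega) (by omega))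
        (mem β n (by omega) (by omega) (by omega)), fun ξ hξ hθ => ?_⟩
      have hs : n + 1 - n = 1 := by omega
      rw [Nat.succ_eq_add_one, EllipticSixJ.hh_swap p q l m le_rfl,
        EllipticSixJ.hh_swap p q (r * l) (r * m) le_rfl,
        EllipticSixJ.hh_swap p q (r * l) (r * m) n.le_succ, Nat.sub_self, Nat.succ_eq_add_one, hs]
      exact H ξ hξ hθ
    · obtain ⟨k, rfl⟩ := Nat.exists_eq_succ_of_ne_zero hkpos.ne'
      obtain ⟨n, rfl⟩ : ∃ n, N = k + n + 2 := ⟨N - k - 2, by omega⟩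
      obtain ⟨α, β, γ, H⟩ := EllipticSixJ.exists_delta_hh_interior hp hq hr ha hb hc hl hm hN
      exact ⟨_, Submodule.add_mem _ (Submodule.add_mem _
        (mem α k (by omega) (by omega) (by omega)) (mem β (k + 1) (by omega) (by omega) (by omega)))
        (mem γ (k + 2) (by omega) (by omega) (by omega)), H⟩
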